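/- Let $L=(L_t)_{t\ge 0}$ be a real-valued Lévy process with Lévy triplet $(\sigma^2,\gamma,\nu)$, that is, $\mathbb E[e^{iuL_t}]=e^{t\psi(u)}$ with $$\psi(u)=-\frac{u^2\sigma^2}{2}+iu\gamma+\int_{\mathbb R}\bigl(e^{iux}-1-iux\,1_{[-1,1]}(x)\bigr)\,\nu(dx),$$ where the Lévy measure has a Lebesgue density $\rho\ge 0$: $\nu(dx)=\rho(x)\,dx$. For $\Delta>0$ and $b\in\mathbb R$ let $P_{\Delta,b}$ be the distribution of $L_\Delta-b\Delta$. Let $I\subset\mathbb R\setminus\{0\}$ be compact, and for $\varepsilon>0$ let $I^{\varepsilon}=\{x\in\mathbb R : d(x,I)\le\varepsilon\}$. Suppose that * $x\mapsto x^2\rho(x)$ is continuous on $\mathbb R$ (at $x=0$ in the sense that it extends continuously from $\mathbb R\setminus\{0\}$); * $x\mapsto x^4\rho(x)$ is bounded on $\mathbb R$; * $\rho$ is positive on $I^{\varepsilon_1}$ for some $\varepsilon_1>0$ with $0\notin I^{\varepsilon_1}$; * for some $b\in\mathbb R$ and some constant $C_0>0$, for all sufficiently small $\Delta>0$ the signed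 measure $y\,P_{\Delta,b}(dy)$ has a Lebesgue density bounded in absolute value by $C_0\log(1/\Delta)$. Then, with the same $b$, there are constants $C,c,\varepsilon_0>0$, not depending on $\Delta$, with $0\notin I^{\varepsilon_0}$, such that for all sufficiently small $\Delta>0$ the measure $y^4P_{\Delta,b}(dy)$ has a Lebesgue density $g_{\Delta,b}\ge 0$ with $$\sup_{y\in\mathbb R} g_{\Delta,b}(y)\le C\Delta\qquad\text{and}\qquad \inf_{y\in I^{\varepsilon_0}} g_{\Delta,b}(y)\ge c\,\Delta .$$ -/

import Mathlib

open MeasureTheory ProbabilityTheory Filter Topology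
open scoped NNReal ENNReal

/-- A real-valued Lévy process `L = (L_t)_{t ≥ 0}`: it starts at `0`, has stationary independent
increments, and has càdlàg sample paths (almost surely). -/
structure IsLevyProcess {Ω : Type*} [MeasurableSpace Ω] (L : ℝ≥0 → Ω → ℝ) (P : Measure Ω) :
    Prop where
  measurable : ∀ t, Measurable (L t)
  start_zero : ∀ᵐ ω ∂P, L 0 ω = 0
  indep_increments : HasIndepIncrements L P
  stationary_increments : ∀ s h, IdentDistrib (fun ω => L (s + h) ω - L s ω) (L h) P P
  cadlag : ∀ᵐ ω ∂P, ∀ t,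
    ContinuousWithinAt (fun s => L s ω) (Set.Ici t) t ∧
      ∃ l : ℝ, Tendsto (fun s => L s ω) (𝓝[<] t) (𝓝 l)

/-- `ν` is a Lévy measure on `ℝ`: `∫ min(1, x²) ν(dx) < ∞` and `ν {0} = 0`. -/
structure IsLevyMeasure (ν : Measure ℝ) : Prop where
  lintegral_lt_top : ∫⁻ x, ENNReal.ofReal (min 1 (x ^ 2)) ∂ν < ∞
  singleton_zero : ν {0} = 0

/-- The Lévy–Khinchin exponent
`ψ(u) = -u²σ²/2 + iuγ + ∫ (e^{iux} - 1 - iux 1_{[-1,1]}(x)) ν(dx)`. -/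
noncomputable def levyExponent (σ γ : ℝ) (ν : Measure ℝ) (u : ℝ) : ℂ :=
  -((u : ℂ) ^ 2 * (σ : ℂ) ^ 2) / 2 + Complex.I * u * γ +
    ∫ x : ℝ, (Complex.exp (Complex.I * u * x) - 1 -
      (Set.Icc (-1 : ℝ) 1).indicator (fun y : ℝ => Complex.I * u * y) x) ∂ν

/-- The process `L` has Lévy triplet `(σ², γ, ν)`: `ν` is a Lévy measure and the law of `L_t` has
characteristic function `e^{tψ(u)}` for every `t ≥ 0`. -/
structure HasLevyTriplet {Ω : Type*} [MeasurableSpace Ω] (L : ℝ≥0 → Ω → ℝ) (P : Measure Ω)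
    (σ γ : ℝ) (ν : Measure ℝ) : Prop where
  isLevyMeasure : IsLevyMeasure ν
  charFun_eq : ∀ (t : ℝ≥0) (u : ℝ),
    charFun (P.map (L t)) u = Complex.exp ((t : ℂ) * levyExponent σ γ ν u)

/-- The Borel measure `ρ(x) dx` on `ℝ`, for a nonnegative function `ρ`. -/
noncomputable def measureOfDensity (ρ : ℝ → ℝ) : Measure ℝ :=
  volume.withDensity fun x => ENNReal.ofReal (ρ x)

/-- `P_{Δ,b}`: the distribution of `L_Δ - bΔ`. -/
noncomputable def driftedLaw {Ω : Type*} [MeasurableSpace Ω] (L : ℝ≥0 → Ω → ℝ) (P : Measure Ω)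
    (b : ℝ) (Δ : ℝ≥0) : Measure ℝ :=
  P.map fun ω => L Δ ω - b * Δ

/-- `y Q(dy)` is a finite signed measure on `ℝ`, with Lebesgue density `f`. The integrability
conditions make both sides of the equation genuine signed measures. -/
def HasSignedFirstMomentDensity (Q : Measure ℝ) (f : ℝ → ℝ) : Prop :=
  Integrable (fun y : ℝ => y) Q ∧ Integrable f volume ∧
    Q.withDensityᵥ (fun y : ℝ => y) = (volume : Measure ℝ).withDensityᵥ f

/-- The (positive, possibly infinite) measure `y⁴ Q(dy)` has Lebesgue density `g`. -/
def HasFourthMomentDensity (Q : Measure ℝ) (g : ℝ → ℝ) : Prop :=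
  Measurable g ∧ (∀ y, 0 ≤ g y) ∧
    Q.withDensity (fun y : ℝ => ENNReal.ofReal (y ^ 4)) = measureOfDensity g

/-!
Write `Q` for the law of `L_Δ - bΔ`, `Q'` for the law at time `Δ / 2`, and
`V = σ² δ₀ + x² ν(dx)`, a finite measure because `x² ρ(x)` and `x⁴ ρ(x)` are bounded.
`Q` and `Q'` have characteristic functions `e^{Δη}` and `e^{Δη/2}`, with `η''` equal to minus the
characteristic function of `V`. Since the former is the square of the latter,
`(e^{Δη})'' = Δ η'' e^{Δη} + 4 ((e^{Δη/2})')²`, which in terms of measures is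

  `y² Q = Δ V ∗ Q + 4 (y Q') ∗ (y Q')`     (`absMoment_two_add_conv`).

Although `η'` is in general not the transform of a measure, both sides are finite measures, and
the identity can be multiplied by powers of `|y|`, which are distributed over the convolutions.

* Second moments are `O(Δ)` and first absolute moments `O(√Δ)`.
* Multiplying by `|y|` (`absMoment_three_le`): the assumed bound `O(log (1/Δ))` on the density of
  `|y| Q` gives a density of `|y|³ Q` of size `O(Δ log (1/Δ))`. No third moment is needed, only
  bounds for `x² ρ(x)` and `|x|³ ρ(x)`. Interpolation gives a bounded density of `y² Q`.
* Multiplying by `y²` (`absMoment_four_le`, `absMoment_four_ge`): up to terms with density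
  `O(Δ^{3/2} log (1/Δ)) = o(Δ)`, `y⁴ Q` is comparable with `Δ` times a measure with bounded
  density, and it dominates `Δ y² (x² ν ∗ Q)`. As `Q` concentrates at the origin, the density of
  the latter is at least a constant times `Δ` near `I`, where `x² ρ(x)` is bounded below.

Densities are bounded throughout by comparing measures, `μ ≤ c • volume`; the pointwise bounds are
recovered at the end by a choice of version (`exists_density_of_le_of_ge`).
-/

/-! ### Second moments from characteristic functions -/

lemma charFun_re_eq_integral_cos (Q : Measure ℝ) [IsProbabilityMeasure Q] (u : ℝ) :
    (charFun Q u).re = ∫ y, Real.cos (u * y) ∂Q := by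
  have hint : Integrable (fun y : ℝ => Complex.exp (u * y * Complex.I)) Q := by
    refine Integrable.mono' (integrable_const (1 : ℝ)) (by fun_prop) (ae_of_all _ fun y => ?_)
    have := Complex.norm_exp_ofReal_mul_I (u * y)
    push_cast at this
    rw [this]
  rw [charFun_apply_real, ← RCLike.re_eq_complex_re, ← integral_re hint]
  refine integral_congr_ae (ae_of_all _ fun y => ?_)
  have := Complex.exp_ofReal_mul_I_re (u * y)
  push_cast at this
  simpa using this

/-- A twice differentiable characteristic function satisfies `1 - Re φ(u) = O(u²)` at the
origin. -/
lemma one_sub_charFun_re_le {Q : Measure ℝ} [IsProbabilityMeasure Q] {φ' : ℝ → ℂ} {φ'' : ℂ}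
    (h1 : ∀ u, HasDerivAt (charFun Q) (φ' u) u) (h2 : HasDerivAt φ' φ'' 0) :
    ∃ C, ∃ δ > 0, 0 ≤ C ∧ ∀ u, |u| < δ → 1 - (charFun Q u).re ≤ C * u ^ 2 := by
  have hG : ∀ u, HasDerivAt (fun u => (charFun Q u).re) (φ' u).re u := fun u =>
    (Complex.reCLM.hasFDerivAt.comp_hasDerivAt u (h1 u))
  have hG' : HasDerivAt (fun u => (φ' u).re) φ''.re 0 :=
    (Complex.reCLM.hasFDerivAt.comp_hasDerivAt 0 h2)
  have h0 : (charFun Q 0).re = 1 := by simp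
  -- the real part of a characteristic function has its maximum at the origin
  have hmax : IsLocalMax (fun u => (charFun Q u).re) 0 := by
    refine Eventually.of_forall fun u => ?_
    simp only [h0]
    exact (Complex.re_le_norm _).trans (norm_charFun_le_one u)
  have hz : (φ' 0).re = 0 := hmax.hasDerivAt_eq_zero (hG 0)
  obtain ⟨C, hC⟩ := hG'.isBigO_sub.bound
  obtain ⟨δ, hδ, hb⟩ := Metric.eventually_nhds_iff.1 hC
  refine ⟨max C 0, δ, hδ, le_max_right _ _, fun u hu => ?_⟩
  have key := (convex_Icc (-|u|) |u|).norm_image_sub_le_of_norm_hasDerivWithin_le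
    (f := fun u => (charFun Q u).re) (f' := fun u => (φ' u).re) (C := max C 0 * |u|)
    (x := 0) (y := u)
    (fun x _ => (hG x).hasDerivWithinAt) (fun x hx => ?_)
    ⟨by simp, abs_nonneg u⟩ ⟨neg_abs_le u, le_abs_self u⟩
  · rw [h0, sub_zero, Real.norm_eq_abs, Real.norm_eq_abs, mul_assoc, abs_mul_abs_self] at key
    have := neg_le_abs ((charFun Q u).re - 1)
    nlinarith
  · have hxu : |x| ≤ |u| := abs_le.2 hx
    have := hb (y := x) (by simpa using hxu.trans_lt hu)
    simp only [hz, sub_zero, Real.norm_eq_abs] at this ⊢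
    exact this.trans (mul_le_mul (le_max_left _ _) hxu (abs_nonneg _) (le_max_right _ _))

/-- A probability measure whose characteristic function is differentiable, with derivative
differentiable at the origin, has a second moment: by Fatou's lemma, from
`∫ (1 - cos (u y)) Q(dy) = O(u²)`. -/
lemma memLp_two_of_hasDerivAt_charFun {Q : Measure ℝ} [IsProbabilityMeasure Q] {φ' : ℝ → ℂ}
    {φ'' : ℂ} (h1 : ∀ u, HasDerivAt (charFun Q) (φ' u) u) (h2 : HasDerivAt φ' φ'' 0) :
    MemLp id 2 Q := by
  obtain ⟨C, δ, hδ, hC0, hC⟩ := one_sub_charFun_re_le h1 h2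
  have hbound : ∀ᶠ n : ℕ in atTop,
      ∫⁻ y, ENNReal.ofReal (((n : ℝ) ^ 2) * (1 - Real.cos ((n : ℝ)⁻¹ * y))) ∂Q
        ≤ ENNReal.ofReal C := by
    have ht : Tendsto (fun n : ℕ => |((n : ℝ)⁻¹)|) atTop (𝓝 0) := by
      simpa using (tendsto_inv_atTop_nhds_zero_nat (𝕜 := ℝ)).abs
    filter_upwards [ht.eventually_lt_const hδ, eventually_gt_atTop 0] with n hn hn0
    have hcos : Integrable (fun y : ℝ => Real.cos ((n : ℝ)⁻¹ * y)) Q :=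
      Integrable.mono' (integrable_const (1 : ℝ)) (by fun_prop)
        (ae_of_all _ fun y => by simpa using Real.abs_cos_le_one _)
    rw [← ofReal_integral_eq_lintegral_ofReal]
    · refine ENNReal.ofReal_le_ofReal ?_
      rw [integral_const_mul, integral_sub (integrable_const _) hcos, ← charFun_re_eq_integral_cos]
      have := hC _ hn
      have hn' : (0 : ℝ) < n := by exact_mod_cast hn0
      simp only [integral_const, probReal_univ, smul_eq_mul, mul_one]
      calc (n : ℝ) ^ 2 * (1 - (charFun Q (n : ℝ)⁻¹).re) ≤ (n : ℝ) ^ 2 * (C * ((n : ℝ)⁻¹) ^ 2) := by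
            gcongr
        _ = C := by field_simp
    · exact ((integrable_const _).sub hcos).const_mul _
    · exact ae_of_all _ fun y => mul_nonneg (sq_nonneg _)
        (by linarith [Real.cos_le_one ((n : ℝ)⁻¹ * y)])
  have hfatou := lintegral_liminf_le (μ := Q) (u := atTop)
    (f := fun (n : ℕ) (y : ℝ) => ENNReal.ofReal (((n : ℝ) ^ 2) * (1 - Real.cos ((n : ℝ)⁻¹ * y))))
    (fun n => by fun_prop)
  have hle : ∫⁻ y, ENNReal.ofReal (2 / Real.pi ^ 2 * y ^ 2) ∂Q ≤ ENNReal.ofReal C := by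
    refine (lintegral_mono fun y => ?_).trans
      (hfatou.trans (liminf_le_of_frequently_le' hbound.frequently))
    refine le_liminf_of_le (by isBoundedDefault) ?_
    obtain ⟨N, hN⟩ := exists_nat_ge |y|
    filter_upwards [eventually_ge_atTop (max N 1)] with n hn
    have hn1 : (1 : ℝ) ≤ n := by exact_mod_cast (le_max_right N 1).trans hn
    have hny : |y| ≤ n := hN.trans (by exact_mod_cast (le_max_left N 1).trans hn)
    refine ENNReal.ofReal_le_ofReal ?_
    have := Real.cos_le_one_sub_mul_cos_sq (x := (n : ℝ)⁻¹ * y) ?_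
    · calc 2 / Real.pi ^ 2 * y ^ 2 = (n : ℝ) ^ 2 * (2 / Real.pi ^ 2 * ((n : ℝ)⁻¹ * y) ^ 2) := by
            field_simp
        _ ≤ _ := by gcongr; linarith
    · rw [abs_mul, abs_of_nonneg (by positivity : (0 : ℝ) ≤ (n : ℝ)⁻¹)]
      calc (n : ℝ)⁻¹ * |y| ≤ (n : ℝ)⁻¹ * n := by gcongr
        _ = 1 := by field_simp
        _ ≤ Real.pi := by linarith [Real.pi_gt_three]
  rw [memLp_two_iff_integrable_sq (by fun_prop)]
  refine ⟨by fun_prop, ?_⟩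
  rw [hasFiniteIntegral_iff_ofReal (ae_of_all _ fun y => sq_nonneg _)]
  have h3 : ∀ y : ℝ, ENNReal.ofReal (2 / Real.pi ^ 2 * y ^ 2)
      = ENNReal.ofReal (2 / Real.pi ^ 2) * ENNReal.ofReal (y ^ 2) :=
    fun y => ENNReal.ofReal_mul (by positivity)
  simp_rw [h3] at hle
  rw [lintegral_const_mul _ (by fun_prop)] at hle
  by_contra hcon
  simp only [id, not_lt, top_le_iff] at hcon
  rw [hcon, ENNReal.mul_top] at hle
  · exact absurd hle (by simp)
  · rw [Ne, ENNReal.ofReal_eq_zero, not_le]; positivity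

/-! ### Differentiating the Lévy–Khinchin exponent -/

lemma norm_exp_I_mul_sub_le (u x : ℝ) : ‖Complex.exp (Complex.I * u * x) - 1‖ ≤ |u| * |x| := by
  have := Real.norm_exp_I_mul_ofReal_sub_one_le (x := u * x)
  rwa [Real.norm_eq_abs, abs_mul, Complex.ofReal_mul, ← mul_assoc] at this

lemma norm_exp_I_mul (u x : ℝ) : ‖Complex.exp (Complex.I * u * x)‖ = 1 := by
  have := Complex.norm_exp_I_mul_ofReal (u * x)
  rwa [Complex.ofReal_mul, ← mul_assoc] at this

lemma norm_exp_I_mul_sub_sub_le (u x : ℝ) :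
    ‖Complex.exp (Complex.I * u * x) - 1 - Complex.I * u * x‖ ≤ 3 * (u ^ 2 * x ^ 2) := by
  have hn : ‖Complex.I * u * x‖ = |u * x| := by simp [abs_mul]
  rw [← mul_pow, ← sq_abs (u * x)]
  rcases le_total |u * x| 1 with h | h
  · have := Complex.norm_exp_sub_one_sub_id_le (x := Complex.I * u * x) (hn ▸ h)
    rw [hn] at this
    nlinarith [sq_nonneg |u * x|]
  · calc _ ≤ ‖Complex.exp (Complex.I * u * x)‖ + ‖(1 : ℂ)‖ + ‖Complex.I * u * x‖ :=
          (norm_sub_le _ _).trans (add_le_add_left (norm_sub_le _ _) _)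
      _ = 1 + 1 + |u * x| := by rw [norm_exp_I_mul, hn, norm_one]
      _ ≤ _ := by nlinarith

lemma norm_levyIntegrand_le (u x : ℝ) :
    ‖Complex.exp (Complex.I * u * x) - 1 -
      (Set.Icc (-1 : ℝ) 1).indicator (fun y : ℝ => Complex.I * u * y) x‖
      ≤ (3 * u ^ 2 + 2) * x ^ 2 := by
  by_cases hx : x ∈ Set.Icc (-1 : ℝ) 1
  · rw [Set.indicator_of_mem hx]
    have := norm_exp_I_mul_sub_sub_le u x
    nlinarith [sq_nonneg x]
  · rw [Set.indicator_of_notMem hx, sub_zero]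
    have h1 : 1 ≤ x ^ 2 := by
      rw [one_le_sq_iff_one_le_abs]
      by_contra hcon
      exact hx (abs_le.1 (not_le.1 hcon).le)
    calc _ ≤ ‖Complex.exp (Complex.I * u * x)‖ + ‖(1 : ℂ)‖ := norm_sub_le _ _
      _ = 2 := by rw [norm_exp_I_mul, norm_one]; norm_num
      _ ≤ _ := by nlinarith [mul_nonneg (sq_nonneg u) (sq_nonneg x)]

/-- The `u`-derivative of the integrand of `levyExponent`. -/
noncomputable def levyIntegrandDeriv (u x : ℝ) : ℂ :=
  Complex.I * x * Complex.exp (Complex.I * u * x) -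
    (Set.Icc (-1 : ℝ) 1).indicator (fun y : ℝ => Complex.I * y) x

lemma norm_levyIntegrandDeriv_le (u x : ℝ) :
    ‖levyIntegrandDeriv u x‖ ≤ (|u| + 1) * x ^ 2 := by
  unfold levyIntegrandDeriv
  by_cases hx : x ∈ Set.Icc (-1 : ℝ) 1
  · rw [Set.indicator_of_mem hx, ← mul_sub_one, norm_mul]
    have h1 := norm_exp_I_mul_sub_le u x
    have h2 : ‖Complex.I * (x : ℂ)‖ = |x| := by simp
    rw [h2, ← sq_abs x]
    nlinarith [abs_nonneg x]
  · rw [Set.indicator_of_notMem hx, sub_zero, norm_mul, norm_exp_I_mul]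
    have h1 : 1 ≤ |x| := by
      by_contra hcon
      exact hx (abs_le.1 (not_le.1 hcon).le)
    have h2 : ‖Complex.I * (x : ℂ)‖ = |x| := by simp
    rw [h2, ← sq_abs x]
    nlinarith [abs_nonneg u]

lemma measurable_levyIntegrandDeriv (u : ℝ) : Measurable (levyIntegrandDeriv u) := by
  unfold levyIntegrandDeriv
  refine Measurable.sub (by fun_prop) (Measurable.indicator (by fun_prop) measurableSet_Icc)

lemma hasDerivAt_coe_complex (u : ℝ) : HasDerivAt (fun u : ℝ => (u : ℂ)) 1 u := by
  simpa using (hasDerivAt_id u).ofReal_comp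

lemma hasDerivAt_exp_I_mul (u x : ℝ) :
    HasDerivAt (fun u : ℝ => Complex.exp (Complex.I * u * x))
      (Complex.I * x * Complex.exp (Complex.I * u * x)) u := by
  have h : HasDerivAt (fun u : ℝ => Complex.I * (u : ℂ) * x) (Complex.I * 1 * x) u :=
    ((Complex.ofRealCLM.hasDerivAt (x := u)).const_mul Complex.I).mul_const (x : ℂ)
  convert h.cexp using 1
  ring

lemma hasDerivAt_levyIntegrand (u x : ℝ) :
    HasDerivAt (fun u : ℝ => Complex.exp (Complex.I * u * x) - 1 -
      (Set.Icc (-1 : ℝ) 1).indicator (fun y : ℝ => Complex.I * u * y) x)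
      (levyIntegrandDeriv u x) u := by
  unfold levyIntegrandDeriv
  refine ((hasDerivAt_exp_I_mul u x).sub_const 1).sub ?_
  by_cases hx : x ∈ Set.Icc (-1 : ℝ) 1
  · simp only [Set.indicator_of_mem hx]
    have := ((Complex.ofRealCLM.hasDerivAt (x := u)).const_mul Complex.I).mul_const (x : ℂ)
    simpa using this
  · simp only [Set.indicator_of_notMem hx]
    exact hasDerivAt_const _ _

/-- The derivative of the Lévy–Khinchin exponent. -/
noncomputable def levyExponentDeriv (σ γ : ℝ) (ν : Measure ℝ) (u : ℝ) : ℂ :=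
  -(u * (σ : ℂ) ^ 2) + Complex.I * γ + ∫ x, levyIntegrandDeriv u x ∂ν

/-- The finite measure `σ² δ₀ + x² ν(dx)`; up to sign, its characteristic function is the second
derivative of the Lévy–Khinchin exponent. -/
noncomputable def jumpVariance (σ : ℝ) (ν : Measure ℝ) : Measure ℝ :=
  ENNReal.ofReal (σ ^ 2) • Measure.dirac 0 + ν.withDensity fun x => ENNReal.ofReal (x ^ 2)

lemma isFiniteMeasure_withDensity_sq {ν : Measure ℝ} (hν : Integrable (fun x => x ^ 2) ν) :
    IsFiniteMeasure (ν.withDensity fun x => ENNReal.ofReal (x ^ 2)) :=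
  isFiniteMeasure_withDensity_ofReal hν.2

lemma isFiniteMeasure_jumpVariance (σ : ℝ) {ν : Measure ℝ} (hν : Integrable (fun x => x ^ 2) ν) :
    IsFiniteMeasure (jumpVariance σ ν) := by
  have := isFiniteMeasure_withDensity_sq hν
  have : IsFiniteMeasure (ENNReal.ofReal (σ ^ 2) • Measure.dirac (0 : ℝ)) :=
    Measure.smul_finite _ (by simp)
  unfold jumpVariance
  infer_instance

lemma charFun_add_measure {μ ν : Measure ℝ} [IsFiniteMeasure μ] [IsFiniteMeasure ν] (u : ℝ) :
    charFun (μ + ν) u = charFun μ u + charFun ν u := by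
  have h : ∀ (m : Measure ℝ) [IsFiniteMeasure m],
      Integrable (fun x : ℝ => Complex.exp (u * x * Complex.I)) m := fun m _ =>
    Integrable.mono' (integrable_const (1 : ℝ)) (by fun_prop) (ae_of_all _ fun y => by
      have := Complex.norm_exp_ofReal_mul_I (u * y)
      push_cast at this
      exact this.le)
  simp only [charFun_apply_real]
  exact integral_add_measure (h μ) (h ν)

lemma charFun_smul_measure {μ : Measure ℝ} {c : ℝ} (hc : 0 ≤ c) (u : ℝ) :
    charFun (ENNReal.ofReal c • μ) u = c * charFun μ u := by
  simp only [charFun_apply_real]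
  rw [integral_smul_measure, ENNReal.toReal_ofReal hc, Complex.real_smul]

lemma charFun_withDensity_ofReal {μ : Measure ℝ} {w : ℝ → ℝ} (hw : Measurable w)
    (hw0 : ∀ x, 0 ≤ w x) (u : ℝ) :
    charFun (μ.withDensity fun x => ENNReal.ofReal (w x)) u
      = ∫ x, w x * Complex.exp (u * x * Complex.I) ∂μ := by
  rw [charFun_apply_real, integral_withDensity_eq_integral_toReal_smul (by fun_prop)
    (ae_of_all _ fun x => ENNReal.ofReal_lt_top)]
  refine integral_congr_ae (ae_of_all _ fun x => ?_)
  simp [ENNReal.toReal_ofReal (hw0 x)]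

lemma charFun_jumpVariance (σ : ℝ) {ν : Measure ℝ} (hν : Integrable (fun x => x ^ 2) ν) (u : ℝ) :
    charFun (jumpVariance σ ν) u
      = (σ : ℂ) ^ 2 + ∫ x, (x : ℂ) ^ 2 * Complex.exp (Complex.I * u * x) ∂ν := by
  have := isFiniteMeasure_withDensity_sq hν
  have : IsFiniteMeasure (ENNReal.ofReal (σ ^ 2) • Measure.dirac (0 : ℝ)) :=
    Measure.smul_finite _ (by simp)
  rw [jumpVariance, charFun_add_measure, charFun_smul_measure (sq_nonneg σ),
    charFun_withDensity_ofReal (by fun_prop) (fun x => sq_nonneg x), charFun_dirac]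
  congr 1
  · simp
  · refine integral_congr_ae (ae_of_all _ fun x => ?_)
    have : (u : ℂ) * x * Complex.I = Complex.I * u * x := by ring
    simp [this]

lemma hasDerivAt_levyExponent (σ γ : ℝ) {ν : Measure ℝ} (hν : Integrable (fun x => x ^ 2) ν)
    (u : ℝ) : HasDerivAt (levyExponent σ γ ν) (levyExponentDeriv σ γ ν u) u := by
  have hint := (hasDerivAt_integral_of_dominated_loc_of_deriv_le (μ := ν)
    (bound := fun x => (|u| + 2) * x ^ 2) (Metric.ball_mem_nhds u one_pos)
    (F := fun (u : ℝ) (x : ℝ) => Complex.exp (Complex.I * u * x) - 1 -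
      (Set.Icc (-1 : ℝ) 1).indicator (fun y : ℝ => Complex.I * u * y) x)
    (F' := levyIntegrandDeriv)
    (Eventually.of_forall fun v => (Measurable.sub (by fun_prop)
      (Measurable.indicator (by fun_prop) measurableSet_Icc)).aestronglyMeasurable)
    ((hν.const_mul (3 * u ^ 2 + 2)).mono' (Measurable.sub (by fun_prop)
      (Measurable.indicator (by fun_prop) measurableSet_Icc)).aestronglyMeasurable
      (ae_of_all _ fun x => norm_levyIntegrand_le u x))
    (measurable_levyIntegrandDeriv u).aestronglyMeasurable
    (ae_of_all _ fun x v hv => (norm_levyIntegrandDeriv_le v x).trans ?_)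
    (hν.const_mul _)
    (ae_of_all _ fun x v _ => hasDerivAt_levyIntegrand v x)).2
  · have h1 : HasDerivAt (fun u : ℝ => -((u : ℂ) ^ 2 * (σ : ℂ) ^ 2) / 2 + Complex.I * u * γ)
        (-(u * (σ : ℂ) ^ 2) + Complex.I * γ) u := by
      have hid := hasDerivAt_coe_complex u
      have ha := ((hid.pow 2).mul_const ((σ : ℂ) ^ 2)).neg.div_const 2
      have hb := (hid.const_mul Complex.I).mul_const (γ : ℂ)
      exact (ha.add hb).congr_deriv (by simp; ring)
    exact h1.add hint
  · have : |v| ≤ |u| + 1 := by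
      have h := Metric.mem_ball.1 hv
      rw [Real.dist_eq] at h
      have := abs_sub_abs_le_abs_sub v u
      linarith
    exact mul_le_mul_of_nonneg_right (by linarith) (sq_nonneg x)

lemma hasDerivAt_levyExponentDeriv (σ γ : ℝ) {ν : Measure ℝ}
    (hν : Integrable (fun x => x ^ 2) ν) (u : ℝ) :
    HasDerivAt (levyExponentDeriv σ γ ν) (-charFun (jumpVariance σ ν) u) u := by
  have hint := (hasDerivAt_integral_of_dominated_loc_of_deriv_le (μ := ν)
    (bound := fun x => x ^ 2) (Metric.ball_mem_nhds u one_pos)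
    (F := levyIntegrandDeriv)
    (F' := fun (u : ℝ) (x : ℝ) => -((x : ℂ) ^ 2 * Complex.exp (Complex.I * u * x)))
    (Eventually.of_forall fun v => (measurable_levyIntegrandDeriv v).aestronglyMeasurable)
    ((hν.const_mul (|u| + 1)).mono' (measurable_levyIntegrandDeriv u).aestronglyMeasurable
      (ae_of_all _ fun x => norm_levyIntegrandDeriv_le u x))
    (by fun_prop)
    (ae_of_all _ fun x v _ => by rw [norm_neg, norm_mul, norm_exp_I_mul]; simp)
    hν
    (ae_of_all _ fun x v _ => ?_)).2
  · rw [charFun_jumpVariance σ hν, neg_add, ← integral_neg]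
    refine HasDerivAt.add ?_ hint
    exact ((((hasDerivAt_coe_complex u).mul_const ((σ : ℂ) ^ 2)).neg.add_const
      (Complex.I * γ))).congr_deriv (by simp)
  · have := ((hasDerivAt_exp_I_mul v x).const_mul (Complex.I * (x : ℂ))).sub_const
      ((Set.Icc (-1 : ℝ) 1).indicator (fun y : ℝ => Complex.I * y) x)
    refine this.congr_deriv ?_
    linear_combination (x : ℂ) ^ 2 * Complex.exp (Complex.I * v * x) * Complex.I_sq

/-! ### The second-moment convolution identity -/

/-- The measure `|y|ⁿ Q(dy)`. -/
noncomputable def absMoment (n : ℕ) (Q : Measure ℝ) : Measure ℝ :=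
  Q.withDensity fun y => ENNReal.ofReal (|y| ^ n)

/-- The positive part `y⁺ Q(dy)` of the signed measure `y Q(dy)`. -/
noncomputable def posPartMoment (Q : Measure ℝ) : Measure ℝ :=
  Q.withDensity fun y => ENNReal.ofReal (max y 0)

/-- The negative part `y⁻ Q(dy)` of the signed measure `y Q(dy)`. -/
noncomputable def negPartMoment (Q : Measure ℝ) : Measure ℝ :=
  Q.withDensity fun y => ENNReal.ofReal (max (-y) 0)

lemma posPartMoment_add_negPartMoment (Q : Measure ℝ) :
    posPartMoment Q + negPartMoment Q = absMoment 1 Q := by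
  unfold posPartMoment negPartMoment absMoment
  rw [← withDensity_add_left (by fun_prop)]
  congr 1
  ext y
  rw [Pi.add_apply, ← ENNReal.ofReal_add (le_max_right _ _) (le_max_right _ _), pow_one]
  congr 1
  rcases le_total y 0 with h | h
  · rw [max_eq_right h, max_eq_left (by linarith), abs_of_nonpos h, zero_add]
  · rw [max_eq_left h, max_eq_right (by linarith), abs_of_nonneg h, add_zero]

lemma isFiniteMeasure_posPartMoment {Q : Measure ℝ} (h : Integrable (fun y => y) Q) :
    IsFiniteMeasure (posPartMoment Q) :=
  isFiniteMeasure_withDensity_ofReal h.pos_part.2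

lemma isFiniteMeasure_negPartMoment {Q : Measure ℝ} (h : Integrable (fun y => y) Q) :
    IsFiniteMeasure (negPartMoment Q) :=
  isFiniteMeasure_withDensity_ofReal h.neg_part.2

lemma charFun_posPart_sub_negPart {Q : Measure ℝ} (h : Integrable (fun y => y) Q) (u : ℝ) :
    charFun (posPartMoment Q) u - charFun (negPartMoment Q) u
      = ∫ y, (y : ℂ) * Complex.exp (u * y * Complex.I) ∂Q := by
  have hexp : ∀ y : ℝ, ‖Complex.exp (u * y * Complex.I)‖ = 1 := fun y => by
    have := Complex.norm_exp_ofReal_mul_I (u * y)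
    push_cast at this
    exact this
  have hi : ∀ w : ℝ → ℝ, Integrable w Q →
      Integrable (fun y => (w y : ℂ) * Complex.exp (u * y * Complex.I)) Q := fun w hw =>
    hw.ofReal.mul_bdd (c := 1) (by fun_prop) (ae_of_all _ fun y => (hexp y).le)
  unfold posPartMoment negPartMoment
  rw [charFun_withDensity_ofReal (by fun_prop) (fun x => le_max_right _ _),
    charFun_withDensity_ofReal (by fun_prop) (fun x => le_max_right _ _),
    ← integral_sub (hi _ h.pos_part) (hi _ h.neg_part)]
  refine integral_congr_ae (ae_of_all _ fun y => ?_)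
  simp only [← sub_mul, ← Complex.ofReal_sub]
  congr 2
  rcases le_total y 0 with h | h
  · rw [max_eq_right h, max_eq_left (by linarith)]; ring
  · rw [max_eq_left h, max_eq_right (by linarith)]; ring

lemma hasDerivAt_charFun {Q : Measure ℝ} [IsFiniteMeasure Q] (h : MemLp id 2 Q) (u : ℝ) :
    HasDerivAt (charFun Q)
      (Complex.I * (charFun (posPartMoment Q) u - charFun (negPartMoment Q) u)) u := by
  have h1 : MemLp id (1 : ℕ) Q := h.mono_exponent (by norm_num)
  have hd : DifferentiableAt ℝ (charFun Q) u :=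
    ((contDiff_charFun h1).differentiable (by simp)).differentiableAt
  have h2 := iteratedDeriv_charFun (t := u) h1
  rw [iteratedDeriv_one] at h2
  rw [charFun_posPart_sub_negPart (h1.integrable (by simp))]
  simpa [h2] using hd.hasDerivAt

lemma iteratedDeriv_two_charFun {Q : Measure ℝ} [IsFiniteMeasure Q] (h : MemLp id 2 Q) (u : ℝ) :
    iteratedDeriv 2 (charFun Q) u = -charFun (absMoment 2 Q) u := by
  rw [iteratedDeriv_charFun (n := 2) (by exact_mod_cast h), absMoment,
    charFun_withDensity_ofReal (by fun_prop) (fun x => by positivity)]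
  simp

section Identity

variable {Q Q' V : Measure ℝ} {Δ : ℝ} {η η' : ℝ → ℂ}

lemma hasDerivAt_charFun_of_eq_exp (hη : ∀ u, HasDerivAt η (η' u) u)
    (hQ : ∀ u, charFun Q u = Complex.exp (Δ * η u)) (u : ℝ) :
    HasDerivAt (charFun Q) (Δ * η' u * charFun Q u) u := by
  rw [funext hQ]
  exact ((hη u).const_mul (Δ : ℂ)).cexp.congr_deriv (by ring)

lemma hasDerivAt_deriv_charFun_of_eq_exp (hη : ∀ u, HasDerivAt η (η' u) u)
    (hη' : ∀ u, HasDerivAt η' (-charFun V u) u)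
    (hQ : ∀ u, charFun Q u = Complex.exp (Δ * η u)) (u : ℝ) :
    HasDerivAt (fun u => Δ * η' u * charFun Q u)
      (-(Δ * charFun V u * charFun Q u) + (Δ * η' u) ^ 2 * charFun Q u) u :=
  (((hη' u).const_mul (Δ : ℂ)).mul (hasDerivAt_charFun_of_eq_exp hη hQ u)).congr_deriv (by ring)

lemma memLp_two_of_charFun_eq_exp [IsProbabilityMeasure Q] (hη : ∀ u, HasDerivAt η (η' u) u)
    (hη' : ∀ u, HasDerivAt η' (-charFun V u) u)
    (hQ : ∀ u, charFun Q u = Complex.exp (Δ * η u)) : MemLp id 2 Q :=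
  memLp_two_of_hasDerivAt_charFun (hasDerivAt_charFun_of_eq_exp hη hQ)
    (hasDerivAt_deriv_charFun_of_eq_exp hη hη' hQ 0)

lemma charFun_absMoment_two [IsProbabilityMeasure Q] (hη : ∀ u, HasDerivAt η (η' u) u)
    (hη' : ∀ u, HasDerivAt η' (-charFun V u) u)
    (hQ : ∀ u, charFun Q u = Complex.exp (Δ * η u)) (u : ℝ) :
    charFun (absMoment 2 Q) u
      = Δ * charFun V u * charFun Q u - (Δ * η' u) ^ 2 * charFun Q u := by
  have h := iteratedDeriv_two_charFun (memLp_two_of_charFun_eq_exp hη hη' hQ) u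
  rw [iteratedDeriv_succ, iteratedDeriv_one,
    funext fun u => (hasDerivAt_charFun_of_eq_exp hη hQ u).deriv,
    (hasDerivAt_deriv_charFun_of_eq_exp hη hη' hQ u).deriv] at h
  linear_combination h

lemma isFiniteMeasure_absMoment_two (h : MemLp id 2 Q) : IsFiniteMeasure (absMoment 2 Q) :=
  isFiniteMeasure_withDensity_ofReal (by simpa using h.integrable_sq.2)

lemma absMoment_two_univ_le [IsProbabilityMeasure Q] (hΔ : 0 ≤ Δ)
    (hη : ∀ u, HasDerivAt η (η' u) u)
    (hη' : ∀ u, HasDerivAt η' (-charFun V u) u)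
    (hQ : ∀ u, charFun Q u = Complex.exp (Δ * η u)) :
    absMoment 2 Q Set.univ ≤ ENNReal.ofReal (Δ * V.real Set.univ + Δ ^ 2 * ‖η' 0‖ ^ 2) := by
  have := isFiniteMeasure_absMoment_two (memLp_two_of_charFun_eq_exp hη hη' hQ)
  have h := congrArg norm (charFun_absMoment_two hη hη' hQ 0)
  rw [← ENNReal.ofReal_toReal (measure_ne_top (absMoment 2 Q) Set.univ)]
  refine ENNReal.ofReal_le_ofReal ?_
  simp only [charFun_zero, probReal_univ, Complex.ofReal_one, mul_one] at h
  rw [Complex.norm_real, Real.norm_of_nonneg measureReal_nonneg] at h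
  calc (absMoment 2 Q).real Set.univ
      ≤ ‖(Δ : ℂ) * (V.real Set.univ : ℝ)‖ + ‖((Δ : ℂ) * η' 0) ^ 2‖ := h ▸ norm_sub_le _ _
    _ = _ := by
      rw [norm_mul, norm_pow, norm_mul, Complex.norm_real, Complex.norm_real,
        Real.norm_of_nonneg hΔ, Real.norm_of_nonneg measureReal_nonneg, mul_pow]

/-- If `Q` and `Q'` have characteristic functions `e^{Δη}` and `e^{Δη/2}`, and `-η''` is the
characteristic function of `V`, then
`y² Q = Δ V ∗ Q + 4 (y Q') ∗ (y Q')` as signed measures. This is the identity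
`(e^{Δη})'' = Δ η'' e^{Δη} + 4 ((e^{Δη/2})')²`; the signed measure `y Q'` is split into its positive
and negative parts, and the mixed terms are moved to the left. -/
lemma absMoment_two_add_conv [IsProbabilityMeasure Q] [IsProbabilityMeasure Q']
    [IsFiniteMeasure V] (hΔ : 0 ≤ Δ) (hη : ∀ u, HasDerivAt η (η' u) u)
    (hη' : ∀ u, HasDerivAt η' (-charFun V u) u)
    (hQ : ∀ u, charFun Q u = Complex.exp (Δ * η u))
    (hQ' : ∀ u, charFun Q' u = Complex.exp ((Δ / 2 : ℝ) * η u)) :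
    absMoment 2 Q + ENNReal.ofReal 8 • (posPartMoment Q' ∗ negPartMoment Q')
      = ENNReal.ofReal Δ • (V ∗ Q) + (ENNReal.ofReal 4 • (posPartMoment Q' ∗ posPartMoment Q')
        + ENNReal.ofReal 4 • (negPartMoment Q' ∗ negPartMoment Q')) := by
  have hm := memLp_two_of_charFun_eq_exp hη hη' hQ
  have hm' := memLp_two_of_charFun_eq_exp hη hη' hQ'
  have hi' : Integrable (fun y => y) Q' := hm'.integrable (by norm_num)
  have := isFiniteMeasure_absMoment_two hm
  have := isFiniteMeasure_posPartMoment hi'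
  have := isFiniteMeasure_negPartMoment hi'
  have hsm : ∀ (c : ℝ) (μ : Measure ℝ) [IsFiniteMeasure μ],
      IsFiniteMeasure (ENNReal.ofReal c • μ) := fun c μ _ => Measure.smul_finite _ (by simp)
  refine Measure.ext_of_charFun (funext fun u => ?_)
  rw [charFun_add_measure, charFun_add_measure, charFun_add_measure,
    charFun_smul_measure (by norm_num), charFun_smul_measure hΔ,
    charFun_smul_measure (by norm_num), charFun_smul_measure (by norm_num),
    charFun_conv, charFun_conv, charFun_conv, charFun_conv, charFun_absMoment_two hη hη' hQ]
  have h1 := (hasDerivAt_charFun hm' u).unique (hasDerivAt_charFun_of_eq_exp hη hQ' u)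
  have h2 : charFun Q u = charFun Q' u ^ 2 := by
    rw [hQ, hQ', ← Complex.exp_nat_mul]
    congr 1
    push_cast
    ring
  have h3 : (charFun (posPartMoment Q') u - charFun (negPartMoment Q') u) ^ 2
      = -((Δ / 2 : ℝ) * η' u * charFun Q' u) ^ 2 := by
    rw [← h1, mul_pow, Complex.I_sq]
    ring
  push_cast at h3 ⊢
  linear_combination (-(Δ * η' u) ^ 2) * h2 - 4 * h3

/-- The second-moment identity as two inequalities: the signed convolution square `(y Q') ∗ (y Q')`
is dominated on both sides by `(|y| Q') ∗ (|y| Q')`. -/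
lemma absMoment_two_le [IsProbabilityMeasure Q] [IsProbabilityMeasure Q']
    [IsFiniteMeasure V] (hΔ : 0 ≤ Δ) (hη : ∀ u, HasDerivAt η (η' u) u)
    (hη' : ∀ u, HasDerivAt η' (-charFun V u) u)
    (hQ : ∀ u, charFun Q u = Complex.exp (Δ * η u))
    (hQ' : ∀ u, charFun Q' u = Complex.exp ((Δ / 2 : ℝ) * η u)) :
    absMoment 2 Q ≤ ENNReal.ofReal Δ • (V ∗ Q) + (4 : ℝ≥0∞) • (absMoment 1 Q' ∗ absMoment 1 Q') ∧
    ENNReal.ofReal Δ • (V ∗ Q)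
      ≤ absMoment 2 Q + (4 : ℝ≥0∞) • (absMoment 1 Q' ∗ absMoment 1 Q') := by
  have h := absMoment_two_add_conv hΔ hη hη' hQ hQ'
  have hi' : Integrable (fun y => y) Q' :=
    (memLp_two_of_charFun_eq_exp hη hη' hQ').integrable (by norm_num)
  have := isFiniteMeasure_posPartMoment hi'
  have := isFiniteMeasure_negPartMoment hi'
  rw [← posPartMoment_add_negPartMoment]
  set M := posPartMoment Q'
  set N := negPartMoment Q'
  have hexp : (4 : ℝ≥0∞) • ((M + N) ∗ (M + N))
      = (ENNReal.ofReal 4 • (M ∗ M) + ENNReal.ofReal 4 • (N ∗ N)) + ENNReal.ofReal 8 • (M ∗ N) := by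
    rw [Measure.add_conv, Measure.conv_add, Measure.conv_add, Measure.conv_comm N M]
    have h8 : ENNReal.ofReal 8 = 4 + 4 := by norm_num
    rw [h8, add_smul]
    norm_num
    abel
  rw [hexp]
  constructor
  · calc absMoment 2 Q ≤ absMoment 2 Q + ENNReal.ofReal 8 • (M ∗ N) := Measure.le_add_right le_rfl
      _ = _ := h
      _ ≤ _ := add_le_add le_rfl (Measure.le_add_right le_rfl)
  · calc ENNReal.ofReal Δ • (V ∗ Q)
        ≤ ENNReal.ofReal Δ • (V ∗ Q) + (ENNReal.ofReal 4 • (M ∗ M) + ENNReal.ofReal 4 • (N ∗ N)) :=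
          Measure.le_add_right le_rfl
      _ = absMoment 2 Q + ENNReal.ofReal 8 • (M ∗ N) := h.symm
      _ ≤ _ := by gcongr; exact Measure.le_add_left le_rfl

end Identity

/-! ### Absolute moments of convolutions -/

lemma absMoment_zero (μ : Measure ℝ) : absMoment 0 μ = μ := by
  simp [absMoment]

lemma absMoment_absMoment (m n : ℕ) (μ : Measure ℝ) :
    absMoment m (absMoment n μ) = absMoment (n + m) μ := by
  unfold absMoment
  rw [← withDensity_mul _ (by fun_prop) (by fun_prop)]
  congr 1
  ext y
  rw [Pi.mul_apply, ← ENNReal.ofReal_mul (by positivity), pow_add]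

lemma absMoment_mono (n : ℕ) {μ ν : Measure ℝ} (h : μ ≤ ν) : absMoment n μ ≤ absMoment n ν := by
  refine Measure.le_iff.2 fun A hA => ?_
  unfold absMoment
  rw [withDensity_apply _ hA, withDensity_apply _ hA]
  exact lintegral_mono' (Measure.restrict_mono le_rfl h) le_rfl

lemma absMoment_add (n : ℕ) (μ ν : Measure ℝ) :
    absMoment n (μ + ν) = absMoment n μ + absMoment n ν := by
  unfold absMoment
  rw [withDensity_add_measure]

lemma absMoment_smul (n : ℕ) (c : ℝ≥0∞) (μ : Measure ℝ) :
    absMoment n (c • μ) = c • absMoment n μ := by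
  unfold absMoment
  rw [withDensity_smul_measure]

instance sFinite_absMoment (n : ℕ) (μ : Measure ℝ) [SFinite μ] : SFinite (absMoment n μ) := by
  unfold absMoment
  infer_instance

lemma lintegral_absMoment (n : ℕ) (μ : Measure ℝ) {h : ℝ → ℝ≥0∞} (hh : Measurable h) :
    ∫⁻ y, h y ∂absMoment n μ = ∫⁻ y, ENNReal.ofReal (|y| ^ n) * h y ∂μ := by
  unfold absMoment
  rw [lintegral_withDensity_eq_lintegral_mul _ (by fun_prop) hh]
  rfl

lemma absMoment_conv_absMoment_apply (m n : ℕ) (μ ν : Measure ℝ) [SFinite μ] [SFinite ν]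
    {A : Set ℝ} (hA : MeasurableSet A) :
    (absMoment m μ ∗ absMoment n ν) A
      = ∫⁻ x, ∫⁻ z, ENNReal.ofReal (|x| ^ m * |z| ^ n) * A.indicator 1 (x + z) ∂ν ∂μ := by
  have h1 : Measurable (A.indicator (1 : ℝ → ℝ≥0∞)) := measurable_one.indicator hA
  have h2 : Measurable fun p : ℝ × ℝ => A.indicator (1 : ℝ → ℝ≥0∞) (p.1 + p.2) :=
    h1.comp measurable_add
  rw [← lintegral_indicator_one hA, Measure.lintegral_conv h1,
    lintegral_absMoment m μ h2.lintegral_prod_right']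
  refine lintegral_congr fun x => ?_
  have h3 : Measurable fun z => A.indicator (1 : ℝ → ℝ≥0∞) (x + z) :=
    h1.comp (measurable_const_add x)
  rw [lintegral_absMoment n ν h3, ← lintegral_const_mul _ (by fun_prop)]
  refine lintegral_congr fun z => ?_
  rw [ENNReal.ofReal_mul (by positivity), mul_assoc]

lemma absMoment_conv_apply (n : ℕ) (μ ν : Measure ℝ) [SFinite μ] [SFinite ν]
    {A : Set ℝ} (hA : MeasurableSet A) :
    absMoment n (μ ∗ ν) A
      = ∫⁻ x, ∫⁻ z, ENNReal.ofReal (|x + z| ^ n) * A.indicator 1 (x + z) ∂ν ∂μ := by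
  have h1 : Measurable (A.indicator (1 : ℝ → ℝ≥0∞)) := measurable_one.indicator hA
  rw [← lintegral_indicator_one hA, lintegral_absMoment n _ h1, Measure.lintegral_conv]
  exact Measurable.mul (by fun_prop) h1

lemma absMoment_one_conv_le (μ ν : Measure ℝ) [SFinite μ] [SFinite ν] :
    absMoment 1 (μ ∗ ν) ≤ absMoment 1 μ ∗ ν + μ ∗ absMoment 1 ν := by
  refine Measure.le_iff.2 fun A hA => ?_
  have e1 := absMoment_conv_absMoment_apply 1 0 μ ν hA
  have e2 := absMoment_conv_absMoment_apply 0 1 μ ν hA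
  have h1 : Measurable fun p : ℝ × ℝ => A.indicator (1 : ℝ → ℝ≥0∞) (p.1 + p.2) :=
    (measurable_one.indicator hA).comp measurable_add
  have h2 : ∀ x, Measurable fun z => A.indicator (1 : ℝ → ℝ≥0∞) (x + z) := fun x =>
    (measurable_one.indicator hA).comp (measurable_const_add x)
  simp only [absMoment_zero, pow_zero, pow_one, mul_one, one_mul] at e1 e2
  rw [Measure.add_apply, absMoment_conv_apply 1 μ ν hA, e1, e2,
    ← lintegral_add_left (Measurable.lintegral_prod_right'
      (f := fun p : ℝ × ℝ => ENNReal.ofReal |p.1| * A.indicator 1 (p.1 + p.2))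
      (Measurable.mul (by fun_prop) h1))]
  refine lintegral_mono fun x => ?_
  dsimp only
  rw [← lintegral_add_left ((h2 x).const_mul _)]
  refine lintegral_mono fun z => ?_
  rw [← add_mul, ← ENNReal.ofReal_add (abs_nonneg _) (abs_nonneg _), pow_one]
  gcongr
  exact abs_add_le x z

lemma absMoment_two_conv_le (μ ν : Measure ℝ) [SFinite μ] [SFinite ν] :
    absMoment 2 (μ ∗ ν) ≤ (2 : ℝ≥0∞) • (absMoment 2 μ ∗ ν + μ ∗ absMoment 2 ν) := by
  refine Measure.le_iff.2 fun A hA => ?_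
  have e1 := absMoment_conv_absMoment_apply 2 0 μ ν hA
  have e2 := absMoment_conv_absMoment_apply 0 2 μ ν hA
  have h1 : Measurable fun p : ℝ × ℝ => A.indicator (1 : ℝ → ℝ≥0∞) (p.1 + p.2) :=
    (measurable_one.indicator hA).comp measurable_add
  have h2 : ∀ x, Measurable fun z => A.indicator (1 : ℝ → ℝ≥0∞) (x + z) := fun x =>
    (measurable_one.indicator hA).comp (measurable_const_add x)
  simp only [absMoment_zero, pow_zero, mul_one, one_mul] at e1 e2
  rw [Measure.smul_apply, Measure.add_apply, absMoment_conv_apply 2 μ ν hA, e1, e2, smul_eq_mul,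
    ← lintegral_add_left (Measurable.lintegral_prod_right'
      (f := fun p : ℝ × ℝ => ENNReal.ofReal (|p.1| ^ 2) * A.indicator 1 (p.1 + p.2))
      (Measurable.mul (by fun_prop) h1)), ← lintegral_const_mul' _ _ (by simp)]
  refine lintegral_mono fun x => ?_
  dsimp only
  rw [← lintegral_add_left ((h2 x).const_mul _),
    ← lintegral_const_mul' _ _ (by simp)]
  refine lintegral_mono fun z => ?_
  have h2' : (2 : ℝ≥0∞) = ENNReal.ofReal 2 := by simp
  rw [← add_mul, ← ENNReal.ofReal_add (by positivity) (by positivity), ← mul_assoc, h2',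
    ← ENNReal.ofReal_mul (by norm_num)]
  gcongr
  rw [sq_abs, sq_abs, sq_abs]
  nlinarith [sq_nonneg (x - z)]

lemma absMoment_dirac_zero {n : ℕ} (hn : n ≠ 0) : absMoment n (Measure.dirac (0 : ℝ)) = 0 := by
  ext A hA
  rw [absMoment, withDensity_apply _ hA, ← lintegral_indicator hA,
    lintegral_dirac' _ (Measurable.indicator (by fun_prop) hA)]
  by_cases h : (0 : ℝ) ∈ A <;> simp [h, hn]

/-- Interpolation `y² ≤ s |y| + s⁻¹ |y|³`. -/
lemma absMoment_two_le_interpolate (μ : Measure ℝ) {s : ℝ} (hs : 0 < s) :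
    absMoment 2 μ ≤ ENNReal.ofReal s • absMoment 1 μ + ENNReal.ofReal s⁻¹ • absMoment 3 μ := by
  unfold absMoment
  rw [← withDensity_smul _ (by fun_prop), ← withDensity_smul _ (by fun_prop),
    ← withDensity_add_left (by fun_prop)]
  refine withDensity_mono (ae_of_all _ fun y => ?_)
  simp only [Pi.add_apply, Pi.smul_apply, smul_eq_mul]
  rw [← ENNReal.ofReal_mul hs.le, ← ENNReal.ofReal_mul (by positivity),
    ← ENNReal.ofReal_add (by positivity) (by positivity)]
  refine ENNReal.ofReal_le_ofReal ?_
  have : s * |y| ^ 1 + s⁻¹ * |y| ^ 3 - |y| ^ 2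
      = s⁻¹ * |y| * ((s - |y| / 2) ^ 2 + 3 / 4 * |y| ^ 2) := by
    field_simp
    ring
  have : 0 ≤ s⁻¹ * |y| * ((s - |y| / 2) ^ 2 + 3 / 4 * |y| ^ 2) := by positivity
  linarith

/-- A bound for the first absolute moment in terms of the second, from `|y| ≤ s + s⁻¹ y²`. -/
lemma absMoment_one_univ_le (μ : Measure ℝ) [IsProbabilityMeasure μ] {s : ℝ} (hs : 0 < s) :
    absMoment 1 μ Set.univ
      ≤ ENNReal.ofReal s + ENNReal.ofReal s⁻¹ * absMoment 2 μ Set.univ := by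
  have hle : absMoment 1 μ
      ≤ ENNReal.ofReal s • absMoment 0 μ + ENNReal.ofReal s⁻¹ • absMoment 2 μ := by
    unfold absMoment
    rw [← withDensity_smul _ (by fun_prop), ← withDensity_smul _ (by fun_prop),
      ← withDensity_add_left (by fun_prop)]
    refine withDensity_mono (ae_of_all _ fun y => ?_)
    simp only [Pi.add_apply, Pi.smul_apply, smul_eq_mul]
    rw [← ENNReal.ofReal_mul hs.le, ← ENNReal.ofReal_mul (by positivity),
      ← ENNReal.ofReal_add (by positivity) (by positivity)]
    refine ENNReal.ofReal_le_ofReal ?_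
    have : s * |y| ^ 0 + s⁻¹ * |y| ^ 2 - |y| ^ 1
        = s⁻¹ * ((s - |y| / 2) ^ 2 + 3 / 4 * |y| ^ 2) := by
      field_simp
      ring
    have : 0 ≤ s⁻¹ * ((s - |y| / 2) ^ 2 + 3 / 4 * |y| ^ 2) := by positivity
    linarith
  simpa [absMoment_zero] using hle Set.univ

/-! ### Measures with bounded Lebesgue density -/

/-- The convolution of a measure with density at most `c` with a measure of mass at most `m` has
density at most `c m`. -/
lemma conv_le_smul_volume {μ ν : Measure ℝ} [SFinite μ] [SFinite ν] {c m : ℝ} (hc : 0 ≤ c)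
    (hμ : μ ≤ ENNReal.ofReal c • volume) (hν : ν Set.univ ≤ ENNReal.ofReal m) :
    μ ∗ ν ≤ ENNReal.ofReal (c * m) • volume := by
  refine Measure.le_iff.2 fun A hA => ?_
  have h1 : Measurable (A.indicator (1 : ℝ → ℝ≥0∞)) := measurable_one.indicator hA
  rw [Measure.conv_comm, ← lintegral_indicator_one hA, Measure.lintegral_conv h1]
  calc ∫⁻ z, ∫⁻ x, A.indicator 1 (z + x) ∂μ ∂ν
      ≤ ∫⁻ _, ENNReal.ofReal c * volume A ∂ν := by
        refine lintegral_mono fun z => ?_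
        have h2 : (fun x => A.indicator (1 : ℝ → ℝ≥0∞) (z + x))
            = ((fun x => z + x) ⁻¹' A).indicator 1 := rfl
        have h3 := hμ ((fun x => z + x) ⁻¹' A)
        rw [h2, lintegral_indicator_one (measurable_const_add z hA)]
        rwa [Measure.smul_apply, smul_eq_mul, measure_preimage_add volume] at h3
    _ ≤ ENNReal.ofReal c * volume A * ENNReal.ofReal m := by rw [lintegral_const]; gcongr
    _ = _ := by
        rw [Measure.smul_apply, smul_eq_mul, ENNReal.ofReal_mul hc]
        ring

lemma smul_le_smul_volume {μ : Measure ℝ} {a c : ℝ} (ha : 0 ≤ a)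
    (h : μ ≤ ENNReal.ofReal c • volume) :
    ENNReal.ofReal a • μ ≤ ENNReal.ofReal (a * c) • volume := by
  rw [ENNReal.ofReal_mul ha, mul_smul]
  gcongr

lemma add_le_smul_volume {μ ν : Measure ℝ} {a c : ℝ} (ha : 0 ≤ a) (hc : 0 ≤ c)
    (hμ : μ ≤ ENNReal.ofReal a • volume) (hν : ν ≤ ENNReal.ofReal c • volume) :
    μ + ν ≤ ENNReal.ofReal (a + c) • volume := by
  rw [ENNReal.ofReal_add ha hc, add_smul]
  gcongr

lemma withDensity_le_smul_volume {w : ℝ → ℝ} {c : ℝ} (h : ∀ᵐ x, w x ≤ c) :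
    volume.withDensity (fun x => ENNReal.ofReal (w x)) ≤ ENNReal.ofReal c • volume := by
  rw [← withDensity_const]
  exact withDensity_mono (h.mono fun x hx => ENNReal.ofReal_le_ofReal hx)

/-! ### From bounds on measures to bounds on densities, and back -/

/-- A measure with Lebesgue density at most `b`, and at least `c` on `S`, has a version of its
density for which both bounds hold everywhere. -/
lemma exists_density_of_le_of_ge {μ : Measure ℝ} [SFinite μ] {b c : ℝ} {S : Set ℝ}
    (hS : MeasurableSet S) (hc : 0 ≤ c) (hcb : c ≤ b) (hμ : μ ≤ ENNReal.ofReal b • volume)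
    (hμS : ∀ A ⊆ S, MeasurableSet A → ENNReal.ofReal c * volume A ≤ μ A) :
    ∃ g : ℝ → ℝ, Measurable g ∧ (∀ y, 0 ≤ g y) ∧ μ = measureOfDensity g ∧ (∀ y, g y ≤ b) ∧
      ∀ y ∈ S, c ≤ g y := by
  have hac : μ ≪ volume :=
    (Measure.absolutelyContinuous_of_le hμ).trans Measure.smul_absolutelyContinuous
  set r := μ.rnDeriv volume
  have hrm : Measurable r := Measure.measurable_rnDeriv _ _
  have hμr : volume.withDensity r = μ := Measure.withDensity_rnDeriv_eq _ _ hac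
  have hle : ∀ᵐ y, r y ≤ ENNReal.ofReal b := by
    refine ae_le_of_forall_setLIntegral_le_of_sigmaFinite hrm fun A hA _ => ?_
    rw [← withDensity_apply _ hA, hμr, setLIntegral_const]
    exact hμ A
  have hge : ∀ᵐ y ∂volume.restrict S, ENNReal.ofReal c ≤ r y := by
    refine ae_le_of_forall_setLIntegral_le_of_sigmaFinite measurable_const fun A hA _ => ?_
    rw [Measure.restrict_restrict hA, ← withDensity_apply r (hA.inter hS), hμr, setLIntegral_const]
    exact hμS _ Set.inter_subset_right (hA.inter hS)
  rw [ae_restrict_iff' hS] at hge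
  refine ⟨fun y => max (min (r y).toReal b) (S.indicator (fun _ => c) y), ?_, ?_, ?_, ?_, ?_⟩
  · exact (hrm.ennreal_toReal.min measurable_const).max (measurable_const.indicator hS)
  · exact fun y => le_max_of_le_right (Set.indicator_nonneg (fun _ _ => hc) y)
  · rw [measureOfDensity, ← hμr]
    refine withDensity_congr_ae ?_
    filter_upwards [hle, hge] with y h1 h2
    have hfin : r y ≠ ∞ := (h1.trans_lt ENNReal.ofReal_lt_top).ne
    have h1' : (r y).toReal ≤ b := ENNReal.toReal_le_of_le_ofReal (hc.trans hcb) h1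
    have h2' : S.indicator (fun _ => c) y ≤ (r y).toReal := by
      by_cases hy : y ∈ S
      · rw [Set.indicator_of_mem hy]
        exact (ENNReal.ofReal_le_iff_le_toReal hfin).1 (h2 hy)
      · rw [Set.indicator_of_notMem hy]
        exact ENNReal.toReal_nonneg
    rw [min_eq_left h1', max_eq_left h2', ENNReal.ofReal_toReal hfin]
  · refine fun y => max_le (min_le_right _ _) ?_
    by_cases hy : y ∈ S
    · rwa [Set.indicator_of_mem hy]
    · rw [Set.indicator_of_notMem hy]
      exact hc.trans hcb
  · exact fun y hy => le_max_of_le_right (Set.indicator_of_mem hy fun _ => c).ge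

/-- A bound on the density of the signed measure `y Q(dy)` bounds the density of `|y| Q(dy)`. -/
lemma absMoment_one_le_of_signedDensity {Q : Measure ℝ} {f : ℝ → ℝ} {F : ℝ}
    (hf : HasSignedFirstMomentDensity Q f) (hF0 : 0 < F) (hF : ∀ y, |f y| ≤ F) :
    absMoment 1 Q ≤ ENNReal.ofReal F • volume := by
  obtain ⟨hi, hfi, heq⟩ := hf
  have hset : ∀ A, MeasurableSet A → ∫ y in A, y ∂Q = ∫ y in A, f y := fun A hA => by
    rw [← withDensityᵥ_apply hi hA, heq, withDensityᵥ_apply hfi hA]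
  refine Measure.le_iff.2 fun A hA => ?_
  rw [Measure.smul_apply, smul_eq_mul]
  rcases eq_or_ne (volume A) ∞ with hv | hv
  · rw [hv, ENNReal.mul_top (by simpa using hF0)]
    exact le_top
  · have hpos : MeasurableSet {y : ℝ | 0 ≤ y} := measurableSet_Ici
    have hbd : ∀ B, MeasurableSet B → volume B ≠ ∞ → |∫ y in B, y ∂Q| ≤ F * volume.real B := by
      intro B hB hBv
      rw [hset B hB, ← Real.norm_eq_abs]
      exact norm_setIntegral_le_of_norm_le_const (lt_top_iff_ne_top.2 hBv) fun y _ => hF y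
    have h1 : ∫ y in A, |y| ∂Q
        = (∫ y in A ∩ {y | 0 ≤ y}, y ∂Q) - ∫ y in A \ {y | 0 ≤ y}, y ∂Q := by
      rw [← integral_inter_add_sdiff hpos hi.abs.integrableOn, sub_eq_add_neg, ← integral_neg]
      congr 1
      · exact setIntegral_congr_fun (hA.inter hpos) fun y hy => abs_of_nonneg hy.2
      · exact setIntegral_congr_fun (hA.diff hpos) fun y hy => abs_of_neg (not_le.1 hy.2)
    have h2 : ∫ y in A, |y| ∂Q ≤ F * volume.real A := by
      have e1 := hbd (A ∩ {y | 0 ≤ y}) (hA.inter hpos)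
        (measure_ne_top_of_subset Set.inter_subset_left hv)
      have e2 := hbd (A \ {y | 0 ≤ y}) (hA.diff hpos) (measure_ne_top_of_subset Set.sdiff_subset hv)
      have e3 := measureReal_inter_add_sdiff (μ := volume) (s := A) hpos hv
      rw [h1, ← e3, mul_add]
      linarith [le_abs_self (∫ y in A ∩ {y | 0 ≤ y}, y ∂Q),
        neg_abs_le (∫ y in A \ {y | 0 ≤ y}, y ∂Q)]
    rw [absMoment, withDensity_apply _ hA]
    simp only [pow_one]
    rw [← ofReal_integral_eq_lintegral_ofReal hi.abs.integrableOn
      (ae_of_all _ fun y => abs_nonneg y)]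
    calc _ ≤ ENNReal.ofReal (F * volume.real A) := ENNReal.ofReal_le_ofReal h2
      _ = _ := by rw [ENNReal.ofReal_mul hF0.le, Measure.real, ENNReal.ofReal_toReal hv]

/-! ### Third and fourth absolute moments -/

lemma absMoment_smul_dirac_add {n : ℕ} (hn : n ≠ 0) (a : ℝ≥0∞) (K : Measure ℝ) :
    absMoment n (a • Measure.dirac 0 + K) = absMoment n K := by
  rw [absMoment_add, absMoment_smul, absMoment_dirac_zero hn, smul_zero, zero_add]

lemma smul_dirac_add_conv (a : ℝ≥0∞) (K μ : Measure ℝ) [SFinite K] [SFinite μ] :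
    (a • Measure.dirac 0 + K) ∗ μ = a • μ + K ∗ μ := by
  rw [Measure.add_conv, Measure.conv_smul_left, Measure.dirac_zero_conv]

section Bounds

variable {Q Q' K : Measure ℝ} [SFinite K] [IsProbabilityMeasure Q] [IsProbabilityMeasure Q']
  {Δ a κ₀ κ₁ κ₂ F F' m₁ m₁' m₂ m₂' n₂ n₃' : ℝ}

/-- The bound on the density of `|y|³ Q(dy)`, obtained by multiplying the second-moment identity
by `|y|`. -/
lemma absMoment_three_le (hΔ : 0 ≤ Δ) (ha : 0 ≤ a) (hF : 0 ≤ F) (hF' : 0 ≤ F') (hκ₀ : 0 ≤ κ₀)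
    (hκ₁ : 0 ≤ κ₁) (hm₁ : 0 ≤ m₁) (hm₂' : 0 ≤ m₂')
    (hQ : absMoment 2 Q ≤ ENNReal.ofReal Δ • ((ENNReal.ofReal a • Measure.dirac 0 + K) ∗ Q)
      + (4 : ℝ≥0∞) • (absMoment 1 Q' ∗ absMoment 1 Q'))
    (hK₀ : K ≤ ENNReal.ofReal κ₀ • volume) (hK₁ : absMoment 1 K ≤ ENNReal.ofReal κ₁ • volume)
    (h₁ : absMoment 1 Q ≤ ENNReal.ofReal F • volume)
    (h₁' : absMoment 1 Q' ≤ ENNReal.ofReal F' • volume)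
    (hmass₁ : absMoment 1 Q Set.univ ≤ ENNReal.ofReal m₁)
    (hmass₂' : absMoment 2 Q' Set.univ ≤ ENNReal.ofReal m₂') :
    absMoment 3 Q ≤ ENNReal.ofReal
      (Δ * (κ₁ * 1 + (a * F + κ₀ * m₁)) + 8 * (F' * m₂')) • volume := by
  have hone : Q Set.univ ≤ ENNReal.ofReal 1 := by simp
  calc absMoment 3 Q = absMoment 1 (absMoment 2 Q) := by rw [absMoment_absMoment]
    _ ≤ _ := absMoment_mono 1 hQ
    _ = ENNReal.ofReal Δ • absMoment 1 ((ENNReal.ofReal a • Measure.dirac 0 + K) ∗ Q)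
        + (4 : ℝ≥0∞) • absMoment 1 (absMoment 1 Q' ∗ absMoment 1 Q') := by
      rw [absMoment_add, absMoment_smul, absMoment_smul]
    _ ≤ ENNReal.ofReal Δ • (absMoment 1 K ∗ Q + (ENNReal.ofReal a • absMoment 1 Q
          + K ∗ absMoment 1 Q))
        + (4 : ℝ≥0∞) • ((absMoment 1 Q' ∗ absMoment 2 Q') + absMoment 1 Q' ∗ absMoment 2 Q') := by
      gcongr
      · refine (absMoment_one_conv_le _ _).trans (le_of_eq ?_)
        rw [absMoment_smul_dirac_add one_ne_zero, smul_dirac_add_conv]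
      · refine (absMoment_one_conv_le _ _).trans (le_of_eq ?_)
        rw [absMoment_absMoment, Measure.conv_comm (absMoment (1 + 1) Q')]
    _ = ENNReal.ofReal Δ • (absMoment 1 K ∗ Q + (ENNReal.ofReal a • absMoment 1 Q
          + K ∗ absMoment 1 Q)) + ENNReal.ofReal 8 • (absMoment 1 Q' ∗ absMoment 2 Q') := by
      rw [← two_smul ℝ≥0∞, smul_smul]
      norm_num
    _ ≤ _ := by
      refine add_le_smul_volume (by positivity) (by positivity)
        (smul_le_smul_volume hΔ (add_le_smul_volume (by positivity) (by positivity)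
          (conv_le_smul_volume hκ₁ hK₁ hone) (add_le_smul_volume (by positivity) (by positivity)
            (smul_le_smul_volume ha h₁) (conv_le_smul_volume hκ₀ hK₀ hmass₁))))
        (smul_le_smul_volume (by norm_num) (conv_le_smul_volume hF' h₁' hmass₂'))

lemma absMoment_two_conv_absMoment_one_le (hn₃' : 0 ≤ n₃')
    (h₃' : absMoment 3 Q' ≤ ENNReal.ofReal n₃' • volume)
    (hmass₁' : absMoment 1 Q' Set.univ ≤ ENNReal.ofReal m₁') :
    (4 : ℝ≥0∞) • absMoment 2 (absMoment 1 Q' ∗ absMoment 1 Q')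
      ≤ ENNReal.ofReal (16 * (n₃' * m₁')) • volume := by
  calc (4 : ℝ≥0∞) • absMoment 2 (absMoment 1 Q' ∗ absMoment 1 Q')
      ≤ (4 : ℝ≥0∞) • (2 : ℝ≥0∞) • ((absMoment 3 Q' ∗ absMoment 1 Q')
        + absMoment 3 Q' ∗ absMoment 1 Q') := by
        gcongr
        refine (absMoment_two_conv_le _ _).trans (le_of_eq ?_)
        rw [absMoment_absMoment, Measure.conv_comm (absMoment 1 Q')]
    _ = ENNReal.ofReal 16 • (absMoment 3 Q' ∗ absMoment 1 Q') := by
        rw [← two_smul ℝ≥0∞, smul_smul, smul_smul]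
        norm_num
    _ ≤ _ := smul_le_smul_volume (by norm_num) (conv_le_smul_volume hn₃' h₃' hmass₁')

/-- The bound on the density of `y⁴ Q(dy)`, obtained by multiplying the second-moment identity
by `y²`. -/
lemma absMoment_four_le (hΔ : 0 ≤ Δ) (ha : 0 ≤ a) (hκ₀ : 0 ≤ κ₀) (hκ₂ : 0 ≤ κ₂)
    (hm₂ : 0 ≤ m₂) (hm₁' : 0 ≤ m₁') (hn₂ : 0 ≤ n₂) (hn₃' : 0 ≤ n₃')
    (hQ : absMoment 2 Q ≤ ENNReal.ofReal Δ • ((ENNReal.ofReal a • Measure.dirac 0 + K) ∗ Q)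
      + (4 : ℝ≥0∞) • (absMoment 1 Q' ∗ absMoment 1 Q'))
    (hK₀ : K ≤ ENNReal.ofReal κ₀ • volume) (hK₂ : absMoment 2 K ≤ ENNReal.ofReal κ₂ • volume)
    (h₂ : absMoment 2 Q ≤ ENNReal.ofReal n₂ • volume)
    (h₃' : absMoment 3 Q' ≤ ENNReal.ofReal n₃' • volume)
    (hmass₂ : absMoment 2 Q Set.univ ≤ ENNReal.ofReal m₂)
    (hmass₁' : absMoment 1 Q' Set.univ ≤ ENNReal.ofReal m₁') :
    absMoment 4 Q ≤ ENNReal.ofReal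
      (Δ * (2 * (κ₂ * 1 + (a * n₂ + κ₀ * m₂))) + 16 * (n₃' * m₁')) • volume := by
  have hone : Q Set.univ ≤ ENNReal.ofReal 1 := by simp
  have h2 : (2 : ℝ≥0∞) = ENNReal.ofReal 2 := by simp
  calc absMoment 4 Q = absMoment 2 (absMoment 2 Q) := by rw [absMoment_absMoment]
    _ ≤ _ := absMoment_mono 2 hQ
    _ = ENNReal.ofReal Δ • absMoment 2 ((ENNReal.ofReal a • Measure.dirac 0 + K) ∗ Q)
        + (4 : ℝ≥0∞) • absMoment 2 (absMoment 1 Q' ∗ absMoment 1 Q') := by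
      rw [absMoment_add, absMoment_smul, absMoment_smul]
    _ ≤ ENNReal.ofReal Δ • (ENNReal.ofReal 2) • (absMoment 2 K ∗ Q
          + (ENNReal.ofReal a • absMoment 2 Q + K ∗ absMoment 2 Q))
        + (4 : ℝ≥0∞) • absMoment 2 (absMoment 1 Q' ∗ absMoment 1 Q') := by
      gcongr
      refine (absMoment_two_conv_le _ _).trans (le_of_eq ?_)
      rw [absMoment_smul_dirac_add two_ne_zero, smul_dirac_add_conv, h2]
    _ ≤ _ := by
      refine add_le_smul_volume (by positivity) (by positivity)
        (smul_le_smul_volume hΔ (smul_le_smul_volume (by norm_num)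
          (add_le_smul_volume (by positivity) (by positivity)
          (conv_le_smul_volume hκ₂ hK₂ hone) (add_le_smul_volume (by positivity) (by positivity)
            (smul_le_smul_volume ha h₂) (conv_le_smul_volume hκ₀ hK₀ hmass₂)))))
        (absMoment_two_conv_absMoment_one_le hn₃' h₃' hmass₁')

/-- On a set `A` away from the origin, near which `K` has density at least `κ`, the density of
`y² (K ∗ Q)(dy)` is bounded below by the mass that `Q` puts near the origin. -/
lemma le_absMoment_two_conv_apply {A : Set ℝ} (hA : MeasurableSet A) {κ r ε : ℝ}
    (hr : 0 ≤ r) (hAr : ∀ y ∈ A, r ≤ |y|)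
    (hK : ∀ B, MeasurableSet B → B ⊆ Metric.cthickening ε A → ENNReal.ofReal κ * volume B ≤ K B) :
    ENNReal.ofReal (r ^ 2) * (ENNReal.ofReal κ * volume A * Q (Set.Icc (-ε) ε))
      ≤ absMoment 2 (K ∗ Q) A := by
  have h1 : Measurable (A.indicator (1 : ℝ → ℝ≥0∞)) := measurable_one.indicator hA
  have hconv : ENNReal.ofReal κ * volume A * Q (Set.Icc (-ε) ε) ≤ (K ∗ Q) A := by
    rw [Measure.conv_comm, ← lintegral_indicator_one (μ := Q ∗ K) hA, Measure.lintegral_conv h1,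
      ← setLIntegral_const (μ := Q)]
    refine (setLIntegral_mono' measurableSet_Icc fun z hz => ?_).trans
      (setLIntegral_le_lintegral _ _)
    have h2 : (fun x => A.indicator (1 : ℝ → ℝ≥0∞) (z + x))
        = ((fun x => z + x) ⁻¹' A).indicator 1 := rfl
    rw [h2, lintegral_indicator_one (measurable_const_add z hA), ← measure_preimage_add volume z A]
    refine hK _ (measurable_const_add z hA) fun x hx => ?_
    refine Metric.mem_cthickening_of_dist_le x (z + x) ε A hx ?_
    rw [Real.dist_eq]
    simpa using abs_le.2 hz
  calc _ ≤ ENNReal.ofReal (r ^ 2) * (K ∗ Q) A := by gcongr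
    _ = ∫⁻ _ in A, ENNReal.ofReal (r ^ 2) ∂(K ∗ Q) := (setLIntegral_const _ _).symm
    _ ≤ ∫⁻ y in A, ENNReal.ofReal (|y| ^ 2) ∂(K ∗ Q) := by
      refine setLIntegral_mono' hA fun y hy => ENNReal.ofReal_le_ofReal ?_
      have := hAr y hy
      gcongr
    _ = _ := by rw [absMoment, withDensity_apply _ hA]

lemma absMoment_four_ge (hn₃' : 0 ≤ n₃')
    (hQ : ENNReal.ofReal Δ • ((ENNReal.ofReal a • Measure.dirac 0 + K) ∗ Q) ≤ absMoment 2 Q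
      + (4 : ℝ≥0∞) • (absMoment 1 Q' ∗ absMoment 1 Q'))
    (h₃' : absMoment 3 Q' ≤ ENNReal.ofReal n₃' • volume)
    (hmass₁' : absMoment 1 Q' Set.univ ≤ ENNReal.ofReal m₁') :
    ENNReal.ofReal Δ • absMoment 2 (K ∗ Q)
      ≤ absMoment 4 Q + ENNReal.ofReal (16 * (n₃' * m₁')) • volume := by
  calc ENNReal.ofReal Δ • absMoment 2 (K ∗ Q)
      ≤ absMoment 2 (ENNReal.ofReal Δ • ((ENNReal.ofReal a • Measure.dirac 0 + K) ∗ Q)) := by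
        rw [absMoment_smul, smul_dirac_add_conv, absMoment_add]
        gcongr
        exact Measure.le_add_left le_rfl
    _ ≤ _ := absMoment_mono 2 hQ
    _ = absMoment 4 Q + (4 : ℝ≥0∞) • absMoment 2 (absMoment 1 Q' ∗ absMoment 1 Q') := by
        rw [absMoment_add, absMoment_smul, absMoment_absMoment]
    _ ≤ _ := by
        exact add_le_add le_rfl (absMoment_two_conv_absMoment_one_le hn₃' h₃' hmass₁')

end Bounds

/-! ### Small-time asymptotics -/

lemma tendsto_half_nhdsGT_zero :
    Tendsto (fun Δ : ℝ≥0 => Δ / 2) (𝓝[>] 0) (𝓝[>] 0) := by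
  refine tendsto_nhdsWithin_iff.2 ⟨?_, ?_⟩
  · have h : Tendsto (fun Δ : ℝ≥0 => Δ / 2) (𝓝 0) (𝓝 (0 / 2)) :=
      (continuous_id.div_const 2).tendsto 0
    rw [zero_div] at h
    exact h.mono_left nhdsWithin_le_nhds
  · filter_upwards [self_mem_nhdsWithin] with Δ hΔ
    exact half_pos (Set.mem_Ioi.1 hΔ)

lemma tendsto_coe_nhdsGT_zero : Tendsto (fun Δ : ℝ≥0 => (Δ : ℝ)) (𝓝[>] 0) (𝓝[>] 0) := by
  refine tendsto_nhdsWithin_iff.2 ⟨?_, ?_⟩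
  · exact (NNReal.continuous_coe.tendsto 0).mono_left nhdsWithin_le_nhds
  · filter_upwards [self_mem_nhdsWithin] with Δ hΔ
    exact NNReal.coe_pos.2 hΔ

lemma eventually_sqrt_mul_log_le {ε : ℝ} (hε : 0 < ε) :
    ∀ᶠ Δ : ℝ≥0 in 𝓝[>] 0, √(Δ : ℝ) * Real.log (1 / (Δ : ℝ)) ≤ ε := by
  have h := (tendsto_log_mul_rpow_nhdsGT_zero (r := 1 / 2) (by norm_num)).neg.comp
    tendsto_coe_nhdsGT_zero
  rw [neg_zero] at h
  filter_upwards [h.eventually_lt_const hε] with Δ hΔ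
  simp only [Function.comp] at hΔ
  rw [Real.sqrt_eq_rpow, one_div (Δ : ℝ), Real.log_inv]
  linarith

lemma eventually_pos_and_le {δ : ℝ} (hδ : 0 < δ) :
    ∀ᶠ Δ : ℝ≥0 in 𝓝[>] 0, 0 < (Δ : ℝ) ∧ (Δ : ℝ) ≤ δ := by
  exact tendsto_coe_nhdsGT_zero.eventually (Ioc_mem_nhdsGT hδ)

lemma one_le_log_one_div {Δ : ℝ} (h0 : 0 < Δ) (h : Δ ≤ 1 / 4) : 1 ≤ Real.log (1 / Δ) := by
  have h1 : Real.log 4 ≤ Real.log (1 / Δ) := by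
    refine Real.log_le_log (by norm_num) ?_
    rw [le_div_iff₀ h0]
    linarith
  have h2 : Real.log 4 = 2 * Real.log 2 := by
    rw [show (4 : ℝ) = 2 ^ 2 by norm_num, Real.log_pow]
    norm_num
  linarith [Real.log_two_gt_d9]

lemma log_one_div_half_le {Δ : ℝ} (h0 : 0 < Δ) (h : Δ ≤ 1 / 4) :
    Real.log (1 / (Δ / 2)) ≤ 2 * Real.log (1 / Δ) := by
  have h1 : Real.log (1 / (Δ / 2)) = Real.log 2 + Real.log (1 / Δ) := by
    rw [← Real.log_mul (by norm_num) (by positivity)]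
    congr 1
    field_simp
  have := one_le_log_one_div h0 h
  linarith [Real.log_two_lt_d9]

section Family

variable {Q : ℝ≥0 → Measure ℝ} {K : Measure ℝ} {a κ₀ κ₁ κ₂ M C : ℝ}

lemma absMoment_one_univ_le_sqrt [∀ Δ, IsProbabilityMeasure (Q Δ)] (hM : 0 ≤ M)
    (hmass : ∀ Δ : ℝ≥0, (Δ : ℝ) ≤ 1 → absMoment 2 (Q Δ) Set.univ ≤ ENNReal.ofReal (M * Δ))
    {Δ : ℝ≥0} (h0 : 0 < (Δ : ℝ)) (h1 : (Δ : ℝ) ≤ 1) :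
    absMoment 1 (Q Δ) Set.univ ≤ ENNReal.ofReal ((1 + M) * √(Δ : ℝ)) := by
  have hs : 0 < √(Δ : ℝ) := Real.sqrt_pos.2 h0
  refine (absMoment_one_univ_le (Q Δ) hs).trans ?_
  calc _ ≤ ENNReal.ofReal √(Δ : ℝ) + ENNReal.ofReal (√(Δ : ℝ))⁻¹ * ENNReal.ofReal (M * Δ) := by
        gcongr
        exact hmass Δ h1
    _ = _ := by
        rw [← ENNReal.ofReal_mul (by positivity), ← ENNReal.ofReal_add hs.le (by positivity)]
        congr 1
        nth_rewrite 3 [← Real.mul_self_sqrt h0.le]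
        field_simp

lemma eventually_absMoment_three_le [∀ Δ, IsProbabilityMeasure (Q Δ)] [SFinite K]
    (ha : 0 ≤ a) (hκ₀ : 0 ≤ κ₀) (hκ₁ : 0 ≤ κ₁) (hM : 0 ≤ M)
    (hC : 0 ≤ C)
    (hQ : ∀ Δ, absMoment 2 (Q Δ)
      ≤ ENNReal.ofReal (Δ : ℝ) • ((ENNReal.ofReal a • Measure.dirac 0 + K) ∗ Q Δ)
        + (4 : ℝ≥0∞) • (absMoment 1 (Q (Δ / 2)) ∗ absMoment 1 (Q (Δ / 2))))
    (hmass : ∀ Δ : ℝ≥0, (Δ : ℝ) ≤ 1 → absMoment 2 (Q Δ) Set.univ ≤ ENNReal.ofReal (M * Δ))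
    (hK₀ : K ≤ ENNReal.ofReal κ₀ • volume) (hK₁ : absMoment 1 K ≤ ENNReal.ofReal κ₁ • volume)
    (h₁ : ∀ᶠ Δ : ℝ≥0 in 𝓝[>] 0,
      absMoment 1 (Q Δ) ≤ ENNReal.ofReal (C * Real.log (1 / (Δ : ℝ))) • volume) :
    ∃ C₃, 0 ≤ C₃ ∧ ∀ᶠ Δ : ℝ≥0 in 𝓝[>] 0,
      absMoment 3 (Q Δ) ≤ ENNReal.ofReal (C₃ * (Δ * Real.log (1 / (Δ : ℝ)))) • volume := by
  refine ⟨κ₁ + a * C + κ₀ * (1 + M) + 8 * C * M, by positivity, ?_⟩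
  filter_upwards [h₁, tendsto_half_nhdsGT_zero.eventually h₁,
    eventually_pos_and_le (δ := 1 / 4) (by norm_num)] with Δ hF hF' ⟨h0, h4⟩
  have hl := one_le_log_one_div h0 h4
  have hl2 := log_one_div_half_le h0 h4
  have hhalf : ((Δ / 2 : ℝ≥0) : ℝ) = (Δ : ℝ) / 2 := by simp
  rw [hhalf] at hF'
  have hl' := one_le_log_one_div (half_pos h0) (by linarith)
  have hmass' := hmass (Δ / 2) (by rw [hhalf]; linarith)
  rw [hhalf] at hmass'
  have hsq : √(Δ : ℝ) ≤ 1 := Real.sqrt_le_one.2 (by linarith)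
  set ℓ := Real.log (1 / (Δ : ℝ))
  set ℓ' := Real.log (1 / ((Δ : ℝ) / 2))
  refine (absMoment_three_le h0.le ha (by positivity) (by positivity) hκ₀ hκ₁ (by positivity)
    (by positivity) (hQ Δ) hK₀ hK₁ hF hF'
    (absMoment_one_univ_le_sqrt hM hmass h0 (by linarith)) hmass').trans ?_
  gcongr
  have e1 : κ₁ * 1 ≤ κ₁ * ℓ := by gcongr
  have e2 : κ₀ * ((1 + M) * √(Δ : ℝ)) ≤ κ₀ * ((1 + M) * ℓ) := by gcongr; linarith
  have e3 : 8 * (C * ℓ' * (M * (Δ / 2))) ≤ 8 * (C * (2 * ℓ) * (M * (Δ / 2))) := by gcongr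
  calc _ ≤ (Δ : ℝ) * (κ₁ * ℓ + (a * (C * ℓ) + κ₀ * ((1 + M) * ℓ)))
        + 8 * (C * (2 * ℓ) * (M * (Δ / 2))) := by gcongr
    _ = _ := by ring

/-- The density of `y² Q(dy)` is bounded. In the fourth-moment bound it enters with the factor
`Δ σ²`, so that boundedness suffices. -/
lemma eventually_absMoment_two_le (hC : 0 ≤ C) {C₃ : ℝ} (hC₃ : 0 ≤ C₃)
    (h₁ : ∀ᶠ Δ : ℝ≥0 in 𝓝[>] 0,
      absMoment 1 (Q Δ) ≤ ENNReal.ofReal (C * Real.log (1 / (Δ : ℝ))) • volume)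
    (h₃ : ∀ᶠ Δ : ℝ≥0 in 𝓝[>] 0,
      absMoment 3 (Q Δ) ≤ ENNReal.ofReal (C₃ * (Δ * Real.log (1 / (Δ : ℝ)))) • volume) :
    ∀ᶠ Δ : ℝ≥0 in 𝓝[>] 0, absMoment 2 (Q Δ) ≤ ENNReal.ofReal (C + C₃) • volume := by
  filter_upwards [h₁, h₃, eventually_pos_and_le (δ := 1 / 4) (by norm_num),
    eventually_sqrt_mul_log_le one_pos] with Δ hF h3 ⟨h0, h4⟩ hs1
  have hl := one_le_log_one_div h0 h4
  have hs : 0 < √(Δ : ℝ) := Real.sqrt_pos.2 h0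
  have e : √(Δ : ℝ) * (C * Real.log (1 / (Δ : ℝ)))
      + (√(Δ : ℝ))⁻¹ * (C₃ * (Δ * Real.log (1 / (Δ : ℝ)))) ≤ C + C₃ := by
    set ℓ := Real.log (1 / (Δ : ℝ))
    have e' : (√(Δ : ℝ))⁻¹ * (C₃ * (Δ * ℓ)) = C₃ * (√(Δ : ℝ) * ℓ) := by
      nth_rewrite 2 [← Real.mul_self_sqrt h0.le]
      field_simp
    rw [e']
    calc _ = (C + C₃) * (√(Δ : ℝ) * ℓ) := by ring
      _ ≤ (C + C₃) * 1 := by gcongr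
      _ = _ := mul_one _
  -- the interpolation parameter `√Δ` balances the two terms
  exact (absMoment_two_le_interpolate (Q Δ) hs).trans ((add_le_smul_volume (by positivity)
    (by positivity) (smul_le_smul_volume hs.le hF)
    (smul_le_smul_volume (inv_nonneg.2 hs.le) h3)).trans (by gcongr))

/-- The error term of the fourth-moment identity is `o(Δ)`. -/
lemma eventually_error_le {ε C₃ : ℝ} (hε : 0 < ε) (hM : 0 ≤ M) (hC₃ : 0 ≤ C₃) :
    ∀ᶠ Δ : ℝ≥0 in 𝓝[>] 0,
      16 * (C₃ * ((Δ : ℝ) / 2 * Real.log (1 / ((Δ : ℝ) / 2))) * ((1 + M) * √((Δ : ℝ) / 2)))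
        ≤ ε * Δ := by
  have hpos : 0 < 8 * C₃ * (1 + M) + 1 := by positivity
  filter_upwards [tendsto_half_nhdsGT_zero.eventually
    (eventually_sqrt_mul_log_le (div_pos hε hpos))] with Δ hΔ
  have hhalf : ((Δ / 2 : ℝ≥0) : ℝ) = (Δ : ℝ) / 2 := by simp
  rw [hhalf, le_div_iff₀ hpos] at hΔ
  set ℓ := Real.log (1 / ((Δ : ℝ) / 2))
  have hle : (8 * C₃ * (1 + M)) * (√((Δ : ℝ) / 2) * ℓ) ≤ ε := by
    rcases le_total 0 (√((Δ : ℝ) / 2) * ℓ) with h | h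
    · nlinarith
    · exact (mul_nonpos_of_nonneg_of_nonpos (by positivity) h).trans hε.le
  calc _ = (8 * C₃ * (1 + M)) * (√((Δ : ℝ) / 2) * ℓ) * Δ := by ring
    _ ≤ ε * Δ := by gcongr

/-- The density of `y⁴ Q(dy)` is `O(Δ)`, and up to `o(Δ)` it is at least that of
`Δ y² (K ∗ Q)(dy)`. -/
theorem eventually_absMoment_four_bounds [∀ Δ, IsProbabilityMeasure (Q Δ)] [SFinite K]
    (ha : 0 ≤ a) (hκ₀ : 0 ≤ κ₀) (hκ₁ : 0 ≤ κ₁)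
    (hκ₂ : 0 ≤ κ₂) (hM : 0 ≤ M) (hC : 0 ≤ C)
    (hQ : ∀ Δ, absMoment 2 (Q Δ)
      ≤ ENNReal.ofReal (Δ : ℝ) • ((ENNReal.ofReal a • Measure.dirac 0 + K) ∗ Q Δ)
        + (4 : ℝ≥0∞) • (absMoment 1 (Q (Δ / 2)) ∗ absMoment 1 (Q (Δ / 2))) ∧
      ENNReal.ofReal (Δ : ℝ) • ((ENNReal.ofReal a • Measure.dirac 0 + K) ∗ Q Δ)
        ≤ absMoment 2 (Q Δ)
          + (4 : ℝ≥0∞) • (absMoment 1 (Q (Δ / 2)) ∗ absMoment 1 (Q (Δ / 2))))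
    (hmass : ∀ Δ : ℝ≥0, (Δ : ℝ) ≤ 1 → absMoment 2 (Q Δ) Set.univ ≤ ENNReal.ofReal (M * Δ))
    (hK₀ : K ≤ ENNReal.ofReal κ₀ • volume) (hK₁ : absMoment 1 K ≤ ENNReal.ofReal κ₁ • volume)
    (hK₂ : absMoment 2 K ≤ ENNReal.ofReal κ₂ • volume)
    (h₁ : ∀ᶠ Δ : ℝ≥0 in 𝓝[>] 0,
      absMoment 1 (Q Δ) ≤ ENNReal.ofReal (C * Real.log (1 / (Δ : ℝ))) • volume) :
    (∃ C₄, 0 < C₄ ∧ ∀ᶠ Δ : ℝ≥0 in 𝓝[>] 0,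
      absMoment 4 (Q Δ) ≤ ENNReal.ofReal (C₄ * Δ) • volume) ∧
    ∀ ε > 0, ∀ᶠ Δ : ℝ≥0 in 𝓝[>] 0, ENNReal.ofReal (Δ : ℝ) • absMoment 2 (K ∗ Q Δ)
      ≤ absMoment 4 (Q Δ) + ENNReal.ofReal (ε * Δ) • volume := by
  obtain ⟨C₃, hC₃, h₃⟩ :=
    eventually_absMoment_three_le ha hκ₀ hκ₁ hM hC (fun Δ => (hQ Δ).1) hmass hK₀ hK₁ h₁
  have h₂ := eventually_absMoment_two_le hC hC₃ h₁ h₃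
  have hhalf : ∀ Δ : ℝ≥0, ((Δ / 2 : ℝ≥0) : ℝ) = (Δ : ℝ) / 2 := fun Δ => by simp
  have h₃' := tendsto_half_nhdsGT_zero.eventually h₃
  simp only [hhalf] at h₃'
  constructor
  · refine ⟨2 * (κ₂ + (a * (C + C₃) + κ₀ * M)) + 1, by positivity, ?_⟩
    filter_upwards [h₂, h₃', eventually_pos_and_le (δ := 1 / 4) (by norm_num),
      eventually_error_le one_pos hM hC₃] with Δ h2 h3' ⟨h0, h4⟩ herr
    have hl' := one_le_log_one_div (half_pos h0) (by linarith)
    have hm₁' := absMoment_one_univ_le_sqrt (Q := Q) hM hmass (Δ := Δ / 2)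
      (by rw [hhalf]; positivity) (by rw [hhalf]; linarith)
    rw [hhalf] at hm₁'
    refine (absMoment_four_le h0.le ha hκ₀ hκ₂ (by positivity) (by positivity) (by positivity)
      (by positivity) (hQ Δ).1 hK₀ hK₂ h2 h3' (hmass Δ (by linarith)) hm₁').trans ?_
    gcongr
    have e : κ₀ * (M * (Δ : ℝ)) ≤ κ₀ * (M * 1) := by gcongr; linarith
    calc _ ≤ (Δ : ℝ) * (2 * (κ₂ * 1 + (a * (C + C₃) + κ₀ * (M * 1)))) + 1 * Δ := by gcongr
      _ = _ := by ring
  · intro ε hε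
    filter_upwards [h₃', eventually_pos_and_le (δ := 1 / 4) (by norm_num),
      eventually_error_le hε hM hC₃] with Δ h3' ⟨h0, h4⟩ herr
    have hl' := one_le_log_one_div (half_pos h0) (by linarith)
    have hm₁' := absMoment_one_univ_le_sqrt (Q := Q) hM hmass (Δ := Δ / 2)
      (by rw [hhalf]; positivity) (by rw [hhalf]; linarith)
    rw [hhalf] at hm₁'
    refine (absMoment_four_ge (by positivity) (hQ Δ).2 h3' hm₁').trans ?_
    gcongr

end Family

/-! ### The Lévy measure and the drifted law -/

lemma withDensity_sq_measureOfDensity {ρ k : ℝ → ℝ} (hρ_meas : Measurable ρ)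
    (hk : ∀ x, x ≠ 0 → k x = x ^ 2 * ρ x) :
    (measureOfDensity ρ).withDensity (fun x => ENNReal.ofReal (x ^ 2))
      = volume.withDensity fun x => ENNReal.ofReal (k x) := by
  rw [measureOfDensity, ← withDensity_mul _ (by fun_prop) (by fun_prop)]
  refine withDensity_congr_ae ?_
  filter_upwards [compl_mem_ae_iff.2 (measure_singleton (μ := (volume : Measure ℝ)) 0)] with x hx
  rw [Pi.mul_apply, hk x hx, ENNReal.ofReal_mul (sq_nonneg x), mul_comm]

lemma absMoment_withDensity_ofReal (n : ℕ) {k : ℝ → ℝ} (hk : Measurable k) :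
    absMoment n (volume.withDensity fun x => ENNReal.ofReal (k x))
      = volume.withDensity fun x => ENNReal.ofReal (|x| ^ n * k x) := by
  unfold absMoment
  rw [← withDensity_mul _ (by fun_prop) (by fun_prop)]
  congr 1
  ext x
  rw [Pi.mul_apply, ENNReal.ofReal_mul (by positivity), mul_comm]

lemma integrable_sq_measureOfDensity {ρ k : ℝ → ℝ} (hρ_meas : Measurable ρ)
    (hk : ∀ x, x ≠ 0 → k x = x ^ 2 * ρ x) (hki : Integrable k) :
    Integrable (fun x : ℝ => x ^ 2) (measureOfDensity ρ) := by
  refine ⟨by fun_prop, ?_⟩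
  rw [hasFiniteIntegral_iff_ofReal (ae_of_all _ fun x => sq_nonneg x), ← setLIntegral_univ,
    ← withDensity_apply _ MeasurableSet.univ, withDensity_sq_measureOfDensity hρ_meas hk,
    withDensity_apply _ MeasurableSet.univ, setLIntegral_univ]
  exact (lintegral_ofReal_le_lintegral_enorm k).trans_lt hki.2

lemma charFun_driftedLaw {Ω : Type*} [MeasurableSpace Ω] {P : Measure Ω} {L : ℝ≥0 → Ω → ℝ}
    {σ γ : ℝ} {ν : Measure ℝ} (hL : ∀ t, Measurable (L t)) (h : HasLevyTriplet L P σ γ ν)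
    (b : ℝ) (Δ : ℝ≥0) (u : ℝ) :
    charFun (driftedLaw L P b Δ) u
      = Complex.exp ((Δ : ℝ) * (levyExponent σ γ ν u - Complex.I * b * u)) := by
  have hmap : driftedLaw L P b Δ = (P.map (L Δ)).map fun x => x + -(b * Δ) := by
    rw [Measure.map_map (by fun_prop) (hL Δ)]
    rfl
  rw [hmap, charFun_map_add_const, h.charFun_eq, ← Complex.exp_add]
  congr 1
  simp
  ring

lemma isProbabilityMeasure_driftedLaw {Ω : Type*} [MeasurableSpace Ω] {P : Measure Ω}
    [IsProbabilityMeasure P] {L : ℝ≥0 → Ω → ℝ} (hL : ∀ t, Measurable (L t)) (b : ℝ) (Δ : ℝ≥0) :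
    IsProbabilityMeasure (driftedLaw L P b Δ) :=
  Measure.isProbabilityMeasure_map ((hL Δ).sub_const _).aemeasurable

/-- Chebyshev's inequality, in the form needed for the concentration at the origin. -/
lemma one_half_le_measure_Icc {Q : Measure ℝ} [IsProbabilityMeasure Q] {m ε : ℝ} (hε : 0 < ε)
    (hQ : absMoment 2 Q Set.univ ≤ ENNReal.ofReal m) (hm : 2 * m ≤ ε ^ 2) :
    ENNReal.ofReal (1 / 2) ≤ Q (Set.Icc (-ε) ε) := by
  have h1 : ENNReal.ofReal (ε ^ 2) * Q (Set.Icc (-ε) ε)ᶜ ≤ ENNReal.ofReal m := by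
    refine le_trans ?_ hQ
    rw [absMoment, withDensity_apply _ MeasurableSet.univ, setLIntegral_univ, ← setLIntegral_const]
    refine (setLIntegral_mono' measurableSet_Icc.compl fun y hy => ?_).trans
      (setLIntegral_le_lintegral _ _)
    have : ε ≤ |y| := by
      by_contra hcon
      exact hy (abs_le.1 (not_le.1 hcon).le)
    gcongr
  have h2 : Q (Set.Icc (-ε) ε)ᶜ ≤ ENNReal.ofReal (1 / 2) := by
    have hε2 : ENNReal.ofReal (ε ^ 2) ≠ 0 := by
      rw [Ne, ENNReal.ofReal_eq_zero, not_le]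
      positivity
    refine (ENNReal.mul_le_mul_iff_right hε2 ENNReal.ofReal_ne_top).1 (h1.trans ?_)
    rw [← ENNReal.ofReal_mul (by positivity)]
    exact ENNReal.ofReal_le_ofReal (by linarith)
  have h3 := prob_add_prob_compl (μ := Q) (measurableSet_Icc (a := -ε) (b := ε))
  by_contra hcon
  have h4 : Q (Set.Icc (-ε) ε) + Q (Set.Icc (-ε) ε)ᶜ
      < ENNReal.ofReal (1 / 2) + ENNReal.ofReal (1 / 2) :=
    ENNReal.add_lt_add_of_lt_of_le (measure_ne_top _ _) (not_le.1 hcon) h2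
  rw [h3, ← ENNReal.ofReal_add (by norm_num) (by norm_num)] at h4
  norm_num at h4

/-- If `x² ρ(x)` has a continuous version `k` and `x⁴ ρ(x)` is bounded, then `k` is bounded and
integrable, and `x² k` is bounded. -/
lemma bounded_and_integrable_of_sq_mul {ρ k : ℝ → ℝ} (hρ_nonneg : ∀ x, 0 ≤ ρ x)
    (hkc : Continuous k) (hk : ∀ x, x ≠ 0 → k x = x ^ 2 * ρ x)
    {B : ℝ} (hB : ∀ x, |x ^ 4 * ρ x| ≤ B) :
    ∃ κ, 0 ≤ κ ∧ (∀ x, k x ≤ κ) ∧ (∀ x, x ^ 2 * k x ≤ B) ∧ Integrable k := by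
  have hB0 : 0 ≤ B := (abs_nonneg _).trans (hB 0)
  have hk4 : ∀ x, x ^ 2 * k x ≤ B := fun x => by
    rcases eq_or_ne x 0 with rfl | hx
    · simpa using hB0
    · rw [hk x hx, ← mul_assoc, ← pow_add]
      exact (le_abs_self _).trans (hB x)
  have hk0 : ∀ x, x ≠ 0 → 0 ≤ k x := fun x hx => by
    rw [hk x hx]
    exact mul_nonneg (sq_nonneg x) (hρ_nonneg x)
  obtain ⟨m, hm⟩ := (isCompact_Icc (a := (-1 : ℝ)) (b := 1)).bddAbove_image hkc.continuousOn
  have hkκ : ∀ x, k x ≤ max m B := fun x => by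
    by_cases hx : x ∈ Set.Icc (-1 : ℝ) 1
    · exact (hm (Set.mem_image_of_mem k hx)).trans (le_max_left _ _)
    · have hx1 : 1 ≤ x ^ 2 := by
        rw [one_le_sq_iff_one_le_abs]
        by_contra hcon
        exact hx (abs_le.1 (not_le.1 hcon).le)
      have hx0 : x ≠ 0 := by
        rintro rfl
        norm_num at hx1
      refine le_trans ?_ ((hk4 x).trans (le_max_right _ _))
      nlinarith [hk0 x hx0]
  refine ⟨max m B, hB0.trans (le_max_right _ _), hkκ, hk4, ?_⟩
  refine (integrable_inv_one_add_sq.const_mul (max m B + B)).mono'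
    hkc.aestronglyMeasurable ?_
  filter_upwards [compl_mem_ae_iff.2 (measure_singleton (μ := (volume : Measure ℝ)) 0)] with x hx
  rw [Real.norm_of_nonneg (hk0 x hx), ← div_eq_mul_inv, le_div_iff₀ (by positivity)]
  linarith [hkκ x, hk4 x]

theorem proposition4p1 {Ω : Type*} [MeasurableSpace Ω] (P : Measure Ω) [IsProbabilityMeasure P]
    (L : ℝ≥0 → Ω → ℝ) (σ γ : ℝ) (ρ : ℝ → ℝ) (I : Set ℝ) (b : ℝ)
    (hL : IsLevyProcess L P)
    (hρ_meas : Measurable ρ) (hρ_nonneg : ∀ x, 0 ≤ ρ x)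
    (htriplet : HasLevyTriplet L P σ γ (measureOfDensity ρ))
    (hI : IsCompact I) (hI0 : I ⊆ {0}ᶜ)
    -- `x ↦ x² ρ(x)` is continuous on `ℝ`, the value at `0` being its limit there
    (hcont : ∃ k : ℝ → ℝ, Continuous k ∧ ∀ x, x ≠ 0 → k x = x ^ 2 * ρ x)
    (hbdd : ∃ B : ℝ, ∀ x, |x ^ 4 * ρ x| ≤ B)
    (hpos : ∃ ε₁ > 0, (0 : ℝ) ∉ Metric.cthickening ε₁ I ∧ ∀ x ∈ Metric.cthickening ε₁ I, 0 < ρ x)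
    (hdens : ∃ C > 0, ∀ᶠ Δ : ℝ≥0 in 𝓝[>] 0, ∃ f : ℝ → ℝ,
      HasSignedFirstMomentDensity (driftedLaw L P b Δ) f ∧
        ∀ y, |f y| ≤ C * Real.log (1 / (Δ : ℝ))) :
    ∃ C > 0, ∃ c > 0, ∃ ε₀ > 0, (0 : ℝ) ∉ Metric.cthickening ε₀ I ∧
      ∀ᶠ Δ : ℝ≥0 in 𝓝[>] 0, ∃ g : ℝ → ℝ,
        HasFourthMomentDensity (driftedLaw L P b Δ) g ∧
          (∀ y, g y ≤ C * (Δ : ℝ)) ∧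
          (∀ y ∈ Metric.cthickening ε₀ I, c * (Δ : ℝ) ≤ g y) := by
  obtain ⟨k, hkc, hk⟩ := hcont
  obtain ⟨B, hB⟩ := hbdd
  obtain ⟨ε₁, hε₁, h0J, hρJ⟩ := hpos
  obtain ⟨C, hC, hdens⟩ := hdens
  obtain ⟨κ, hκ, hkκ, hkB, hki⟩ := bounded_and_integrable_of_sq_mul hρ_nonneg hkc hk hB
  have hB0 : 0 ≤ B := (abs_nonneg _).trans (hB 0)
  have hν := integrable_sq_measureOfDensity hρ_meas hk hki
  set K : Measure ℝ := volume.withDensity fun x => ENNReal.ofReal (k x) with hK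
  set V := jumpVariance σ (measureOfDensity ρ) with hV
  have hVK : V = ENNReal.ofReal (σ ^ 2) • Measure.dirac 0 + K := by
    rw [hV, jumpVariance, withDensity_sq_measureOfDensity hρ_meas hk]
  have hVfin : IsFiniteMeasure V := isFiniteMeasure_jumpVariance σ hν
  have hprob := isProbabilityMeasure_driftedLaw (P := P) hL.measurable b
  have hQ := charFun_driftedLaw hL.measurable htriplet b
  set Q := driftedLaw L P b
  have hη : ∀ u : ℝ, HasDerivAt
      (fun u : ℝ => levyExponent σ γ (measureOfDensity ρ) u - Complex.I * b * u)
      (levyExponentDeriv σ γ (measureOfDensity ρ) u - Complex.I * b) u := fun u =>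
    ((hasDerivAt_levyExponent σ γ hν u).sub
      ((hasDerivAt_coe_complex u).const_mul (Complex.I * b))).congr_deriv (by simp)
  have hη' : ∀ u : ℝ, HasDerivAt
      (fun u : ℝ => levyExponentDeriv σ γ (measureOfDensity ρ) u - Complex.I * b)
      (-charFun V u) u := fun u => (hasDerivAt_levyExponentDeriv σ γ hν u).sub_const _
  have hQ2 : ∀ Δ, absMoment 2 (Q Δ)
      ≤ ENNReal.ofReal (Δ : ℝ) • ((ENNReal.ofReal (σ ^ 2) • Measure.dirac 0 + K) ∗ Q Δ)
        + (4 : ℝ≥0∞) • (absMoment 1 (Q (Δ / 2)) ∗ absMoment 1 (Q (Δ / 2))) ∧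
      ENNReal.ofReal (Δ : ℝ) • ((ENNReal.ofReal (σ ^ 2) • Measure.dirac 0 + K) ∗ Q Δ)
        ≤ absMoment 2 (Q Δ)
          + (4 : ℝ≥0∞) • (absMoment 1 (Q (Δ / 2)) ∗ absMoment 1 (Q (Δ / 2))) := fun Δ => by
    rw [← hVK]
    refine absMoment_two_le Δ.coe_nonneg hη hη' (hQ Δ) fun u => ?_
    rw [hQ]
    simp
  set η₀ := levyExponentDeriv σ γ (measureOfDensity ρ) 0 - Complex.I * b
  set M := V.real Set.univ + ‖η₀‖ ^ 2 with hMdef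
  have hM : 0 ≤ M := by positivity
  have hmass : ∀ Δ : ℝ≥0, (Δ : ℝ) ≤ 1 →
      absMoment 2 (Q Δ) Set.univ ≤ ENNReal.ofReal (M * Δ) := fun Δ hΔ => by
    refine (absMoment_two_univ_le Δ.coe_nonneg hη hη' (hQ Δ)).trans (ENNReal.ofReal_le_ofReal ?_)
    have hle : (Δ : ℝ) ^ 2 ≤ Δ := by nlinarith [Δ.coe_nonneg]
    calc _ ≤ (Δ : ℝ) * V.real Set.univ + Δ * ‖η₀‖ ^ 2 := by gcongr
      _ = M * Δ := by rw [hMdef]; ring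
  have h₁ : ∀ᶠ Δ : ℝ≥0 in 𝓝[>] 0,
      absMoment 1 (Q Δ) ≤ ENNReal.ofReal (C * Real.log (1 / (Δ : ℝ))) • volume := by
    filter_upwards [hdens, eventually_pos_and_le (δ := 1 / 4) (by norm_num)] with
      Δ ⟨f, hf, hfb⟩ ⟨h0, h4⟩
    have := one_le_log_one_div h0 h4
    exact absMoment_one_le_of_signedDensity hf (by positivity) hfb
  have hK₀ : K ≤ ENNReal.ofReal κ • volume := withDensity_le_smul_volume (ae_of_all _ hkκ)
  have hK₁ : absMoment 1 K ≤ ENNReal.ofReal (κ + B) • volume := by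
    rw [hK, absMoment_withDensity_ofReal 1 hkc.measurable]
    refine withDensity_le_smul_volume ?_
    filter_upwards [compl_mem_ae_iff.2 (measure_singleton (μ := (volume : Measure ℝ)) 0)] with x hx
    have hk0 : 0 ≤ k x := by
      rw [hk x hx]
      exact mul_nonneg (sq_nonneg x) (hρ_nonneg x)
    have hx : |x| ≤ 1 + x ^ 2 := by nlinarith [sq_abs x, sq_nonneg (|x| - 1), abs_nonneg x]
    calc |x| ^ 1 * k x ≤ (1 + x ^ 2) * k x := by rw [pow_one]; gcongr
      _ ≤ κ + B := by linarith [hkκ x, hkB x]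
  have hK₂ : absMoment 2 K ≤ ENNReal.ofReal B • volume := by
    rw [hK, absMoment_withDensity_ofReal 2 hkc.measurable]
    exact withDensity_le_smul_volume (ae_of_all _ fun x => by simpa using hkB x)
  obtain ⟨⟨C₄, hC₄, hup⟩, hlow⟩ := eventually_absMoment_four_bounds (sq_nonneg σ) hκ
    (by positivity) hB0 hM hC.le hQ2 hmass hK₀ hK₁ hK₂ h₁
  have hJ : IsCompact (Metric.cthickening ε₁ I) := hI.cthickening
  obtain ⟨κ', hκ', hkκ'⟩ := hJ.exists_forall_le' (a := 0) hkc.continuousOn fun x hx => by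
    have hx0 : x ≠ 0 := fun h => h0J (h ▸ hx)
    rw [hk x hx0]
    have := hρJ x hx
    positivity
  obtain ⟨r, hr, hJr⟩ := hJ.exists_forall_le' (a := 0) continuous_abs.continuousOn
    fun x hx => abs_pos.2 fun h => h0J (h ▸ hx)
  have hε₀ : 0 < ε₁ / 2 := by positivity
  have hSJ : Metric.cthickening (ε₁ / 2) I ⊆ Metric.cthickening ε₁ I :=
    Metric.cthickening_mono (by linarith) I
  -- half of the lower bound is lost to the concentration estimate, half of the rest to the error
  set c₀ := r ^ 2 * κ' / 4 with hc₀
  have hc₀pos : 0 < c₀ := by positivity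
  refine ⟨C₄, hC₄, min c₀ C₄, lt_min hc₀pos hC₄, ε₁ / 2, hε₀, fun h => h0J (hSJ h), ?_⟩
  have hδ : 0 < min 1 ((ε₁ / 2) ^ 2 / (2 * M + 1)) := by positivity
  filter_upwards [hup, hlow c₀ hc₀pos, eventually_pos_and_le hδ] with Δ hΔup hΔlow ⟨h0, hΔ⟩
  have hΔ1 : (Δ : ℝ) ≤ 1 := hΔ.trans (min_le_left _ _)
  have hhalf : ENNReal.ofReal (1 / 2) ≤ Q Δ (Set.Icc (-(ε₁ / 2)) (ε₁ / 2)) := by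
    refine one_half_le_measure_Icc hε₀ (hmass Δ hΔ1) ?_
    have := (le_div_iff₀ (by positivity)).1 (hΔ.trans (min_le_right _ _))
    linarith
  have hmin : ∀ A ⊆ Metric.cthickening (ε₁ / 2) I, MeasurableSet A →
      ENNReal.ofReal (min c₀ C₄ * Δ) * volume A ≤ absMoment 4 (Q Δ) A := by
    intro A hAS hA
    have hAv : volume A ≠ ∞ := measure_ne_top_of_subset (hAS.trans hSJ) hJ.measure_lt_top.ne
    have hconv := le_absMoment_two_conv_apply (Q := Q Δ) (K := K) hA (κ := κ') (ε := ε₁ / 2) hr.le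
      (fun y hy => hJr y (hSJ (hAS hy))) fun D hD hDA => by
        rw [hK, withDensity_apply _ hD, ← setLIntegral_const]
        refine setLIntegral_mono' hD fun x hx => ENNReal.ofReal_le_ofReal (hkκ' x ?_)
        have h1 := Metric.cthickening_subset_of_subset (ε₁ / 2) hAS (hDA hx)
        have h2 := Metric.cthickening_cthickening_subset hε₀.le hε₀.le I h1
        rwa [add_halves] at h2
    have hA' : ENNReal.ofReal (2 * c₀ * Δ) * volume A
        ≤ absMoment 4 (Q Δ) A + ENNReal.ofReal (c₀ * Δ) * volume A := by
      calc ENNReal.ofReal (2 * c₀ * Δ) * volume A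
          = ENNReal.ofReal Δ * (ENNReal.ofReal (r ^ 2)
            * (ENNReal.ofReal κ' * volume A * ENNReal.ofReal (1 / 2))) := by
            have : 2 * c₀ * Δ = Δ * (r ^ 2 * (κ' * (1 / 2))) := by rw [hc₀]; ring
            rw [this, ENNReal.ofReal_mul h0.le, ENNReal.ofReal_mul (by positivity),
              ENNReal.ofReal_mul hκ'.le]
            ring
        _ ≤ ENNReal.ofReal Δ * absMoment 2 (K ∗ Q Δ) A := by
            gcongr
            exact le_trans (by gcongr) hconv
        _ ≤ _ := hΔlow A
    calc ENNReal.ofReal (min c₀ C₄ * Δ) * volume A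
        ≤ ENNReal.ofReal (c₀ * Δ) * volume A := by
          gcongr
          exact min_le_left _ _
      _ ≤ absMoment 4 (Q Δ) A := by
          refine (ENNReal.add_le_add_iff_right
            (ENNReal.mul_ne_top ENNReal.ofReal_ne_top hAv)).1 (le_trans (le_of_eq ?_) hA')
          rw [← add_mul, ← ENNReal.ofReal_add (by positivity) (by positivity)]
          congr 2
          ring
  obtain ⟨g, hgm, hg0, hg, hgC, hgc⟩ := exists_density_of_le_of_ge
    Metric.isClosed_cthickening.measurableSet (by positivity)
    (mul_le_mul_of_nonneg_right (min_le_right _ _) h0.le) hΔup hmin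
  refine ⟨g, ⟨hgm, hg0, ?_⟩, hgC, hgc⟩
  rw [← hg, absMoment]
  simp only [(show Even 4 by decide).pow_abs]
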